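/- Let $k$ be a field of characteristic zero, let $R=k[X_1,\ldots,X_d]$ and $\mathfrak m=(X_1,\ldots,X_d)$. Let $I\subset R$ be a strongly stable ideal generated in degree two. That is, $I$ is generated by monomials of degree two, and for every monomial $m\in I$, every $j$ with $X_j\mid m$ and every $i<j$, one has $mX_i/X_j\in I$. Suppose that $I$ has the $G_d$ property: for every prime $\mathfrak p\supseteq I$ with $\operatorname{ht}\mathfrak p<d$, the minimal number of generators of $I_{\mathfrak p}$ satisfies $\mu(I_{\mathfrak p})\le\operatorname{ht}\mathfrak p$. Let $I'=\bigcup_{t\ge 0}(I:\mathfrak m^t)$ be the saturation of $I$. Then $I'$ has the sliding depth property: whenever $f_1,\ldots,f_n$ is a minimal generating set of $I'$ (it generates $I'$ and no proper subset of it does), one has $$\operatorname{depth} H_i(f_1,\ldots,f_n)\ \ge\ d-n+i\qquad\text{for every } i\ge 0,$$ where $H_i(f_1,\ldots,f_n)$ is the $i$-th Koszul homology module of $f_1,\ldots,f_n$ over $R$, and depth is taken with respect to $\mathfrak m$, with $\operatorname{depth} M=\infty$ if $\mathfrak mM=M$ (in particular if $M=0$). -/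

import Mathlib

noncomputable section

/-! ### Monomial ideals and strongly stable ideals in `k[X_0, …, X_{d-1}]` -/

section Monomial

variable {k : Type*} [Field k] {d : ℕ}

/-- `I` is generated by monomials. -/
def IsMonomialIdeal (I : Ideal (MvPolynomial (Fin d) k)) : Prop :=
  ∃ S : Set (Fin d →₀ ℕ), I = Ideal.span ((fun m => MvPolynomial.monomial m (1 : k)) '' S)

/-- A monomial ideal `I` is strongly stable if `m * X_i / X_j ∈ I` for every monomial `m ∈ I`,
every `j` with `X_j ∣ m`, and every `i < j`. Monomials are given by their exponent vectors. -/
def IsStronglyStable (I : Ideal (MvPolynomial (Fin d) k)) : Prop :=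
  IsMonomialIdeal I ∧
    ∀ m : Fin d →₀ ℕ, MvPolynomial.monomial m (1 : k) ∈ I →
      ∀ i j : Fin d, i < j → m j ≠ 0 →
        MvPolynomial.monomial (m - Finsupp.single j 1 + Finsupp.single i 1) (1 : k) ∈ I

/-- `I` is generated by homogeneous polynomials of degree `e`. -/
def IsGeneratedInDegree (e : ℕ) (I : Ideal (MvPolynomial (Fin d) k)) : Prop :=
  ∃ S : Set (MvPolynomial (Fin d) k), (∀ f ∈ S, f.IsHomogeneous e) ∧ I = Ideal.span S

end Monomial

section General

variable {R : Type*} [CommRing R]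

/-- The property `G_s`: `μ(I_p) ≤ ht p` for every prime `p ⊇ I` with `ht p < s`, where `μ` is the
minimal number of generators. -/
def HasG (s : ℕ) (I : Ideal R) : Prop :=
  ∀ (p : Ideal R) [p.IsPrime], I ≤ p → p.height < (s : ℕ∞) →
    ((I.map (algebraMap R (Localization.AtPrime p))).spanFinrank : ℕ∞) ≤ p.height

/-- The saturation `⋃ t, (I : J ^ t)` of `I` with respect to `J`. -/
def idealSaturation (I J : Ideal R) : Ideal R :=
  ⨆ t : ℕ, I.colon ((J ^ t : Ideal R) : Set R)

/-- The family `f` minimally generates `L`: it generates `L` and no proper subfamily does. -/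
def IsMinimalGeneratingFamily {n : ℕ} (f : Fin n → R) (L : Ideal R) : Prop :=
  Ideal.span (Set.range f) = L ∧ ∀ i : Fin n, Ideal.span (f '' {i}ᶜ) ≠ L

/-- The depth of `M` with respect to the ideal `J`: the supremum of the lengths of `M`-regular
sequences in `J`. Weak regularity is used, so that the value is `⊤` when `J M = M` (in
particular for `M = 0`), as usual; if `M` is finitely generated over a Noetherian ring
and `J M ≠ M`, then every weakly regular sequence in `J` is regular. -/
def moduleDepth (J : Ideal R) (M : Type*) [AddCommGroup M] [Module R M] : ℕ∞ :=
  ⨆ (rs : List R) (_ : (∀ r ∈ rs, r ∈ J) ∧ RingTheory.Sequence.IsWeaklyRegular M rs),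
    (rs.length : ℕ∞)

/-! ### The Koszul complex -/

/-- The Koszul differential of `f_1, …, f_n` on the exterior algebra of `R^n`: contraction with the
linear form `e_i ↦ f_i`, so `∂ (v ∧ w) = f(v) w - v ∧ ∂ w`. -/
def koszulDifferential {n : ℕ} (f : Fin n → R) :
    ExteriorAlgebra R (Fin n → R) →ₗ[R] ExteriorAlgebra R (Fin n → R) :=
  CliffordAlgebra.contractLeft (Q := (0 : QuadraticForm R (Fin n → R)))
    (Fintype.linearCombination R f)

theorem koszulDifferential_ι_mul {n : ℕ} (f : Fin n → R) (v : Fin n → R)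
    (x : ExteriorAlgebra R (Fin n → R)) :
    koszulDifferential f (ExteriorAlgebra.ι R v * x) =
      (∑ i, v i * f i) • x - ExteriorAlgebra.ι R v * koszulDifferential f x := by
  have h := CliffordAlgebra.contractLeft_ι_mul (Q := (0 : QuadraticForm R (Fin n → R)))
    (Fintype.linearCombination R f) v x
  simpa [koszulDifferential, Fintype.linearCombination_apply] using h

theorem koszulDifferential_comp_self {n : ℕ} (f : Fin n → R)
    (x : ExteriorAlgebra R (Fin n → R)) :
    koszulDifferential f (koszulDifferential f x) = 0 :=
  CliffordAlgebra.contractLeft_contractLeft _ _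

/-- The Koszul differential lowers the exterior degree by one. -/
theorem koszulDifferential_mem {n : ℕ} (f : Fin n → R) (i : ℕ)
    {x : ExteriorAlgebra R (Fin n → R)} (hx : x ∈ ⋀[R]^(i + 1) (Fin n → R)) :
    koszulDifferential f x ∈ ⋀[R]^i (Fin n → R) := by
  induction i generalizing x with
  | zero =>
    rw [ExteriorAlgebra.exteriorPower, zero_add, pow_one] at hx
    obtain ⟨v, rfl⟩ := hx
    rw [← mul_one (ExteriorAlgebra.ι R v), koszulDifferential_ι_mul]
    have h1 : koszulDifferential f (1 : ExteriorAlgebra R (Fin n → R)) = 0 :=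
      CliffordAlgebra.contractLeft_one _ _
    rw [h1, mul_zero, sub_zero, ExteriorAlgebra.exteriorPower, pow_zero]
    exact Submodule.smul_mem _ _ (Submodule.one_le.mp le_rfl)
  | succ i ih =>
    rw [ExteriorAlgebra.exteriorPower, pow_succ'] at hx
    induction hx using Submodule.mul_induction_on' with
    | mem_mul_mem a ha b hb =>
      obtain ⟨v, rfl⟩ := ha
      rw [koszulDifferential_ι_mul]
      refine Submodule.sub_mem _ (Submodule.smul_mem _ _ hb) ?_
      rw [ExteriorAlgebra.exteriorPower, pow_succ']
      exact Submodule.mul_mem_mul (LinearMap.mem_range_self _ v) (ih hb)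
    | add a _ b _ ha hb =>
      rw [map_add]
      exact Submodule.add_mem _ ha hb

/-- The `i`-cycles `ker (⋀^i R^n → ⋀^(i-1) R^n)` (for `i = 0` all of `⋀^0 R^n = R`). -/
def koszulCycles {n : ℕ} (f : Fin n → R) (i : ℕ) : Submodule R (ExteriorAlgebra R (Fin n → R)) :=
  (⋀[R]^i (Fin n → R)) ⊓ LinearMap.ker (koszulDifferential f)

/-- The `i`-boundaries, the image of `⋀^(i+1) R^n → ⋀^i R^n`. -/
def koszulBoundaries {n : ℕ} (f : Fin n → R) (i : ℕ) :
    Submodule R (ExteriorAlgebra R (Fin n → R)) :=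
  (⋀[R]^(i + 1) (Fin n → R)).map (koszulDifferential f)

theorem koszulBoundaries_le_koszulCycles {n : ℕ} (f : Fin n → R) (i : ℕ) :
    koszulBoundaries f i ≤ koszulCycles f i := by
  rintro _ ⟨x, hx, rfl⟩
  exact ⟨koszulDifferential_mem f i hx, koszulDifferential_comp_self f x⟩

/-- The `i`-th Koszul homology module `H_i(f_1, …, f_n)`. -/
abbrev KoszulHomology {n : ℕ} (f : Fin n → R) (i : ℕ) : Type _ :=
  koszulCycles f i ⧸ (koszulBoundaries f i).submoduleOf (koszulCycles f i)

end General

/-- An ideal `L` of `k[X_0, …, X_{d-1}]` has sliding depth if `depth H_i(f_1, …, f_n) ≥ d - n + i`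
for all `i` and every minimal generating family `f_1, …, f_n` of `L`, where depth is taken with
respect to `(X_0, …, X_{d-1})`. The inequality is written without subtraction. -/
def HasSlidingDepth {k : Type*} [Field k] {d : ℕ} (L : Ideal (MvPolynomial (Fin d) k)) : Prop :=
  ∀ (n : ℕ) (f : Fin n → MvPolynomial (Fin d) k), IsMinimalGeneratingFamily f L →
    ∀ i : ℕ, ((d + i : ℕ) : ℕ∞) ≤
      moduleDepth (MvPolynomial.idealOfVars (Fin d) k) (KoszulHomology f i) + (n : ℕ∞)

end

/-!
The hypotheses leave very few ideals. Write `z` for the last index, let `r` be maximal with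
`X_r ^ 2 ∈ I` (if there is no such `r`, then `I = 0`), and suppose `r < z`. Counting generators of
`I_p` for the primes `p` generated by initial segments of the variables, the property `G_d` forces
`X_i X_j ∈ I` for all `i < r` and all `j` (`X_mul_X_mem_of_hasG`). Since the saturation of a
strongly stable ideal is obtained by setting `X_z = 1`, it is generated by the `X_i` with `i ≤ r` if
`X_r X_z ∈ I`, and otherwise it is `(X_i : i < r) + X_r (X_i : i ∈ P)` with `r ∈ P ⊆ [r, z)`
(`idealSaturation_eq_span_X`, `idealSaturation_eq_span_X_sup`). If `r = z`, it is the unit ideal.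

The depth estimate says that there is one list `w` of elements of the maximal ideal whose first
`d - n + i` elements are weakly regular on `H_i(f_1, …, f_n)`, for every `i`
(`IsKoszulRegular`). In this form it behaves well in the long exact sequence that relates the Koszul
homology of a family to that of the family with one more element `a`:

* if `a` is in the ideal generated by the family, the sequence splits into short exact sequences
  with a retraction, so the estimate passes in both directions. Hence it holds for all finite
  generating families of an ideal or for none (`IsKoszulRegular.of_span_eq`);
* if `a` is the first element of `w`, then `H_i` is replaced by `H_i / a H_i`, and `w` by its tail
  (`IsKoszulRegular.extend_of_cons`). This takes care of the generators `X_i`;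
* for the family `X_r X_i`, `i ∈ P`, the element `X_r` kills the positive Koszul homology because
  the variables have none. So adding a generator gives short exact sequences again, and the
  estimate follows by induction on the number of elements of `P`
  (`isWeaklyRegular_koszulHomology_X_smul_varFamily`). All regular
  sequences consist of variables, followed by zeros where the homology vanishes.
-/

noncomputable section

/-! ### Weakly regular sequences in short exact sequences -/

section WeaklyRegular

open RingTheory.Sequence Function

variable {R : Type*} [CommRing R]

/-- If the first element of a sequence is regular on the cokernel, reducing modulo that element
keeps a short exact sequence exact on the left. -/
theorem QuotSMulTop.map_injective_of_exact {A B C : Type*} [AddCommGroup A] [Module R A]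
    [AddCommGroup B] [Module R B] [AddCommGroup C] [Module R C] {f : A →ₗ[R] B} {g : B →ₗ[R] C}
    (hf : Injective f) (hfg : Exact f g) {r : R} (hr : IsSMulRegular C r) :
    Injective (QuotSMulTop.map r f) := by
  rw [← LinearMap.ker_eq_bot, LinearMap.ker_eq_bot']
  intro m hm
  obtain ⟨a, rfl⟩ := Submodule.mkQ_surjective _ m
  rw [Submodule.mkQ_apply, QuotSMulTop.map_apply_mk, Submodule.Quotient.mk_eq_zero,
    Submodule.mem_smul_pointwise_iff_exists] at hm
  obtain ⟨b, -, hb⟩ := hm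
  have hgb : g b = 0 := by
    apply hr.right_eq_zero_of_smul
    rw [← map_smul, hb, hfg.apply_apply_eq_zero]
  obtain ⟨a', rfl⟩ := (hfg b).1 hgb
  rw [← map_smul] at hb
  rw [Submodule.mkQ_apply, Submodule.Quotient.mk_eq_zero, ← hf hb]
  exact Submodule.smul_mem_pointwise_smul _ _ _ trivial

theorem isWeaklyRegular_middle_of_exact (rs : List R) {A B C : Type*} [AddCommGroup A] [Module R A]
    [AddCommGroup B] [Module R B] [AddCommGroup C] [Module R C] {f : A →ₗ[R] B} {g : B →ₗ[R] C}
    (hf : Injective f) (hfg : Exact f g) (hg : Surjective g)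
    (hA : IsWeaklyRegular A rs) (hC : IsWeaklyRegular C rs) : IsWeaklyRegular B rs := by
  induction rs generalizing A B C with
  | nil => exact .nil R B
  | cons r rs ih =>
    rw [isWeaklyRegular_cons_iff] at hA hC ⊢
    exact ⟨isSMulRegular_of_range_eq_ker hf hfg.linearMap_ker_eq.symm hA.1 hC.1,
      ih (QuotSMulTop.map_injective_of_exact hf hfg hC.1) (QuotSMulTop.map_exact r hfg hg)
        (QuotSMulTop.map_surjective r hg) hA.2 hC.2⟩

theorem isWeaklyRegular_left_of_exact (rs : List R) {A B C : Type*} [AddCommGroup A] [Module R A]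
    [AddCommGroup B] [Module R B] [AddCommGroup C] [Module R C] {f : A →ₗ[R] B} {g : B →ₗ[R] C}
    (hf : Injective f) (hfg : Exact f g) (hg : Surjective g)
    (hB : IsWeaklyRegular B rs) (hC : IsWeaklyRegular C rs) : IsWeaklyRegular A rs := by
  induction rs generalizing A B C with
  | nil => exact .nil R A
  | cons r rs ih =>
    rw [isWeaklyRegular_cons_iff] at hB hC ⊢
    exact ⟨hB.1.of_injective f hf,
      ih (QuotSMulTop.map_injective_of_exact hf hfg hC.1) (QuotSMulTop.map_exact r hfg hg)
        (QuotSMulTop.map_surjective r hg) hB.2 hC.2⟩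

theorem RingTheory.Sequence.IsWeaklyRegular.of_leftInverse (rs : List R) {A B : Type*}
    [AddCommGroup A] [Module R A] [AddCommGroup B] [Module R B] {s : A →ₗ[R] B} {p : B →ₗ[R] A}
    (h : p ∘ₗ s = .id) (hB : IsWeaklyRegular B rs) : IsWeaklyRegular A rs := by
  induction rs generalizing A B with
  | nil => exact .nil R A
  | cons r rs ih =>
    rw [isWeaklyRegular_cons_iff] at hB ⊢
    have hs : Injective s := fun x y hxy => by
      simpa using (LinearMap.congr_fun h x).symm.trans
        ((congrArg p hxy).trans (LinearMap.congr_fun h y))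
    refine ⟨hB.1.of_injective s hs, ih (s := QuotSMulTop.map r s) (p := QuotSMulTop.map r p) ?_ hB.2⟩
    rw [← QuotSMulTop.map_comp, h, QuotSMulTop.map_id]

theorem isWeaklyRegular_of_subsingleton (rs : List R) {A : Type*} [AddCommGroup A] [Module R A]
    [Subsingleton A] : IsWeaklyRegular A rs := by
  induction rs generalizing A with
  | nil => exact .nil R A
  | cons r rs ih =>
    rw [isWeaklyRegular_cons_iff]
    exact ⟨fun x y _ => Subsingleton.elim x y, ih⟩

theorem RingTheory.Sequence.IsWeaklyRegular.take_of_le {w : List R} {a b : ℕ} {A : Type*}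
    [AddCommGroup A] [Module R A] (h : IsWeaklyRegular A (w.take b)) (hab : a ≤ b) :
    IsWeaklyRegular A (w.take a) := by
  rw [← List.take_append_drop a (w.take b), isWeaklyRegular_append_iff, List.take_take,
    min_eq_left hab] at h
  exact h.1

theorem isWeaklyRegular_quotSMulTop_iff {A B : Type*} [AddCommGroup A] [Module R A]
    [AddCommGroup B] [Module R B] {g : A →ₗ[R] B} (hg : Surjective g) {a : R}
    (hk : ∀ z, g z = 0 ↔ ∃ y, a • y = z) (w : List R) :
    IsWeaklyRegular (QuotSMulTop a A) w ↔ IsWeaklyRegular B w := by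
  refine LinearEquiv.isWeaklyRegular_congr ((Submodule.quotEquivOfEq _ _ ?_).trans
    (g.quotKerEquivOfSurjective hg)) w
  ext z
  simp [Submodule.mem_smul_pointwise_iff_exists, hk]

end WeaklyRegular

/-! ### The exterior algebra of a split extension by a free module of rank one -/

section Split

variable {R : Type*} [CommRing R] {M M' : Type*} [AddCommGroup M] [Module R M]
  [AddCommGroup M'] [Module R M']

/-- Contraction with a linear form, the Koszul differential of the form. -/
abbrev extContract (φ : Module.Dual R M) : ExteriorAlgebra R M →ₗ[R] ExteriorAlgebra R M :=
  CliffordAlgebra.contractLeft (Q := (0 : QuadraticForm R M)) φ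

theorem extContract_ι_mul (φ : Module.Dual R M) (v : M) (x : ExteriorAlgebra R M) :
    extContract φ (ExteriorAlgebra.ι R v * x) =
      φ v • x - ExteriorAlgebra.ι R v * extContract φ x :=
  CliffordAlgebra.contractLeft_ι_mul (Q := (0 : QuadraticForm R M)) φ v x

theorem extContract_algebraMap (φ : Module.Dual R M) (r : R) :
    extContract φ (algebraMap R (ExteriorAlgebra R M) r) = 0 :=
  CliffordAlgebra.contractLeft_algebraMap (Q := (0 : QuadraticForm R M)) φ r

theorem ExteriorAlgebra.left_induction {P : ExteriorAlgebra R M → Prop}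
    (algebraMap : ∀ r : R, P (algebraMap R _ r)) (add : ∀ x y, P x → P y → P (x + y))
    (ι_mul : ∀ x m, P x → P (ExteriorAlgebra.ι R m * x)) (x : ExteriorAlgebra R M) : P x :=
  CliffordAlgebra.left_induction (Q := (0 : QuadraticForm R M)) algebraMap add ι_mul x

theorem extContract_map (g : M →ₗ[R] M') (φ : Module.Dual R M') (x : ExteriorAlgebra R M) :
    extContract φ (ExteriorAlgebra.map g x) =
      ExteriorAlgebra.map g (extContract (φ ∘ₗ g) x) := by
  induction x using ExteriorAlgebra.left_induction with
  | algebraMap r => rw [AlgHom.commutes, extContract_algebraMap, extContract_algebraMap, map_zero]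
  | add x y hx hy => simp only [map_add, hx, hy]
  | ι_mul x m hx =>
    rw [map_mul, ExteriorAlgebra.map_apply_ι, extContract_ι_mul, extContract_ι_mul, hx, map_sub,
      map_smul, map_mul, ExteriorAlgebra.map_apply_ι, LinearMap.comp_apply]

theorem ExteriorAlgebra.map_mem_exteriorPower (g : M →ₗ[R] M') (i : ℕ) {x : ExteriorAlgebra R M}
    (hx : x ∈ ⋀[R]^i M) : ExteriorAlgebra.map g x ∈ ⋀[R]^i M' := by
  induction i generalizing x with
  | zero =>
    rw [ExteriorAlgebra.exteriorPower, pow_zero] at hx ⊢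
    obtain ⟨r, rfl⟩ := Submodule.mem_one.1 hx
    exact Submodule.mem_one.2 ⟨r, by simp⟩
  | succ i ih =>
    rw [ExteriorAlgebra.exteriorPower, pow_succ'] at hx ⊢
    induction hx using Submodule.mul_induction_on' with
    | mem_mul_mem a ha b hb =>
      obtain ⟨v, rfl⟩ := ha
      rw [map_mul, ExteriorAlgebra.map_apply_ι]
      exact Submodule.mul_mem_mul (LinearMap.mem_range_self _ _) (ih hb)
    | add a _ b _ ha hb =>
      rw [map_add]
      exact Submodule.add_mem _ ha hb

theorem ExteriorAlgebra.ι_mul_mem_exteriorPower (v : M) (i : ℕ) {x : ExteriorAlgebra R M}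
    (hx : x ∈ ⋀[R]^i M) : ExteriorAlgebra.ι R v * x ∈ ⋀[R]^(i + 1) M := by
  rw [ExteriorAlgebra.exteriorPower, pow_succ']
  exact Submodule.mul_mem_mul (LinearMap.mem_range_self _ _) hx

theorem extContract_mem (φ : Module.Dual R M) (i : ℕ) {x : ExteriorAlgebra R M}
    (hx : x ∈ ⋀[R]^(i + 1) M) : extContract φ x ∈ ⋀[R]^i M := by
  induction i generalizing x with
  | zero =>
    rw [ExteriorAlgebra.exteriorPower, zero_add, pow_one] at hx
    obtain ⟨v, rfl⟩ := hx
    rw [← mul_one (ExteriorAlgebra.ι R v), extContract_ι_mul,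
      ← map_one (algebraMap R (ExteriorAlgebra R M)), extContract_algebraMap, mul_zero, sub_zero,
      map_one, ExteriorAlgebra.exteriorPower, pow_zero]
    exact Submodule.smul_mem _ _ (Submodule.one_le.mp le_rfl)
  | succ i ih =>
    rw [ExteriorAlgebra.exteriorPower, pow_succ'] at hx
    induction hx using Submodule.mul_induction_on' with
    | mem_mul_mem a ha b hb =>
      obtain ⟨v, rfl⟩ := ha
      rw [extContract_ι_mul]
      exact Submodule.sub_mem _ (Submodule.smul_mem _ _ hb)
        (ExteriorAlgebra.ι_mul_mem_exteriorPower v i (ih hb))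
    | add a _ b _ ha hb =>
      rw [map_add]
      exact Submodule.add_mem _ ha hb

/-- A presentation of `M'` as the direct sum of a submodule isomorphic to `M` and a free submodule
of rank one with basis `e`, by the inclusion and projection of `M` and the coordinate `δ`. -/
structure RankOneExtension (R M M' : Type*) [CommRing R] [AddCommGroup M] [Module R M]
    [AddCommGroup M'] [Module R M'] where
  /-- The inclusion of `M`. -/
  inc : M →ₗ[R] M'
  /-- The projection to `M`. -/
  pr : M' →ₗ[R] M
  /-- The additional basis vector. -/
  e : M'
  /-- The coordinate at `e`. -/
  δ : Module.Dual R M'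
  pr_inc : pr ∘ₗ inc = .id
  δ_inc : δ ∘ₗ inc = 0
  pr_e : pr e = 0
  δ_e : δ e = 1
  decomp : ∀ v, v = inc (pr v) + δ v • e

namespace RankOneExtension

variable (S : RankOneExtension R M M')

/-- The inclusion `⋀ M → ⋀ M'`. -/
def incl : ExteriorAlgebra R M →ₗ[R] ExteriorAlgebra R M' :=
  (ExteriorAlgebra.map S.inc).toLinearMap

/-- The projection `⋀ M' → ⋀ M` sending `e` to `0`. -/
def proj : ExteriorAlgebra R M' →ₗ[R] ExteriorAlgebra R M :=
  (ExteriorAlgebra.map S.pr).toLinearMap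

/-- The map `⋀ M → ⋀ M'` given by `y ↦ e ∧ y`. -/
def wedge : ExteriorAlgebra R M →ₗ[R] ExteriorAlgebra R M' :=
  LinearMap.mulLeft R (ExteriorAlgebra.ι R S.e) ∘ₗ S.incl

/-- The map `⋀ M' → ⋀ M` sending `x + e ∧ y` to `y`, for `x` and `y` in `⋀ M`. -/
def coef : ExteriorAlgebra R M' →ₗ[R] ExteriorAlgebra R M :=
  S.proj ∘ₗ extContract S.δ

theorem incl_ι_mul (v : M) (x : ExteriorAlgebra R M) :
    S.incl (ExteriorAlgebra.ι R v * x) = ExteriorAlgebra.ι R (S.inc v) * S.incl x := by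
  simp [incl]

theorem proj_ι_mul (v : M') (x : ExteriorAlgebra R M') :
    S.proj (ExteriorAlgebra.ι R v * x) = ExteriorAlgebra.ι R (S.pr v) * S.proj x := by
  simp [proj]

theorem wedge_apply (x : ExteriorAlgebra R M) :
    S.wedge x = ExteriorAlgebra.ι R S.e * S.incl x := rfl

theorem coef_apply (x : ExteriorAlgebra R M') : S.coef x = S.proj (extContract S.δ x) := rfl

theorem proj_incl (x : ExteriorAlgebra R M) : S.proj (S.incl x) = x := by
  change (ExteriorAlgebra.map S.pr) (ExteriorAlgebra.map S.inc x) = x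
  rw [← AlgHom.comp_apply, ExteriorAlgebra.map_comp_map, S.pr_inc, ExteriorAlgebra.map_id]
  rfl

theorem extContract_incl (φ : Module.Dual R M') (x : ExteriorAlgebra R M) :
    extContract φ (S.incl x) = S.incl (extContract (φ ∘ₗ S.inc) x) :=
  extContract_map S.inc φ x

theorem extContract_wedge (φ : Module.Dual R M') (x : ExteriorAlgebra R M) :
    extContract φ (S.wedge x) =
      φ S.e • S.incl x - S.wedge (extContract (φ ∘ₗ S.inc) x) := by
  rw [wedge_apply, extContract_ι_mul, extContract_incl, wedge_apply]

theorem coef_incl (x : ExteriorAlgebra R M) : S.coef (S.incl x) = 0 := by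
  rw [coef_apply, extContract_incl, S.δ_inc]
  simp [extContract]

theorem proj_wedge (x : ExteriorAlgebra R M) : S.proj (S.wedge x) = 0 := by
  rw [wedge_apply, proj_ι_mul, S.pr_e, map_zero, zero_mul]

theorem coef_wedge (x : ExteriorAlgebra R M) : S.coef (S.wedge x) = x := by
  rw [coef_apply, extContract_wedge, S.δ_inc, S.δ_e]
  simp [extContract, proj_incl]

theorem incl_proj_add_wedge_coef (x : ExteriorAlgebra R M') :
    S.incl (S.proj x) + S.wedge (S.coef x) = x := by
  induction x using ExteriorAlgebra.left_induction with
  | algebraMap r => simp [coef_apply, incl, proj]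
  | add x y hx hy =>
    simp only [map_add]
    nth_rw 3 [← hx, ← hy]
    abel
  | ι_mul x v hx =>
    have h1 : ExteriorAlgebra.ι R v =
        ExteriorAlgebra.ι R (S.inc (S.pr v)) + S.δ v • ExteriorAlgebra.ι R S.e := by
      conv_lhs => rw [S.decomp v]
      rw [map_add, map_smul]
    have h2 := ExteriorAlgebra.ι_add_mul_swap (R := R) (S.inc (S.pr v)) S.e
    have h3 := ExteriorAlgebra.ι_sq_zero (R := R) S.e
    have hc : S.coef (ExteriorAlgebra.ι R v * x) =
        S.δ v • S.proj x - ExteriorAlgebra.ι R (S.pr v) * S.coef x := by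
      rw [coef_apply, extContract_ι_mul, map_sub, map_smul, proj_ι_mul, coef_apply]
    rw [hc, proj_ι_mul, incl_ι_mul]
    nth_rw 4 [← hx]
    rw [h1]
    simp only [wedge_apply, map_sub, map_smul, incl_ι_mul, mul_add, add_mul,
      smul_mul_assoc, ← mul_assoc, h3, smul_zero, add_zero]
    rw [eq_neg_of_add_eq_zero_left h2, neg_mul]
    abel

variable {S}

theorem proj_extContract (φ : Module.Dual R M') (x : ExteriorAlgebra R M') :
    S.proj (extContract φ x) =
      extContract (φ ∘ₗ S.inc) (S.proj x) + φ S.e • S.coef x := by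
  conv_lhs => rw [← S.incl_proj_add_wedge_coef x]
  rw [map_add, extContract_incl, extContract_wedge, map_add, map_sub, map_smul, proj_incl,
    proj_incl, proj_wedge, sub_zero]

theorem coef_extContract (φ : Module.Dual R M') (x : ExteriorAlgebra R M') :
    S.coef (extContract φ x) = - extContract (φ ∘ₗ S.inc) (S.coef x) := by
  conv_lhs => rw [← S.incl_proj_add_wedge_coef x]
  rw [map_add, extContract_incl, extContract_wedge, map_add, map_sub, map_smul, coef_incl,
    coef_incl, coef_wedge, smul_zero, zero_add, zero_sub]

theorem incl_mem {i : ℕ} {x : ExteriorAlgebra R M} (hx : x ∈ ⋀[R]^i M) :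
    S.incl x ∈ ⋀[R]^i M' :=
  ExteriorAlgebra.map_mem_exteriorPower S.inc i hx

theorem proj_mem {i : ℕ} {x : ExteriorAlgebra R M'} (hx : x ∈ ⋀[R]^i M') :
    S.proj x ∈ ⋀[R]^i M :=
  ExteriorAlgebra.map_mem_exteriorPower S.pr i hx

theorem wedge_mem {i : ℕ} {x : ExteriorAlgebra R M} (hx : x ∈ ⋀[R]^i M) :
    S.wedge x ∈ ⋀[R]^(i + 1) M' :=
  ExteriorAlgebra.ι_mul_mem_exteriorPower S.e i (incl_mem hx)

theorem coef_mem {i : ℕ} {x : ExteriorAlgebra R M'} (hx : x ∈ ⋀[R]^(i + 1) M') :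
    S.coef x ∈ ⋀[R]^i M :=
  proj_mem (extContract_mem S.δ i hx)

end RankOneExtension

end Split

/-! ### The long exact sequence of Koszul homology for an additional ring element -/

section KoszulSequence

open Function

variable {R : Type*} [CommRing R] {n n' : ℕ}

theorem koszulDifferential_eq_extContract (f : Fin n → R) :
    koszulDifferential f = extContract (Fintype.linearCombination R f) := rfl

/-- The homology class of a Koszul cycle. -/
def koszulClass (f : Fin n → R) (i : ℕ) : koszulCycles f i →ₗ[R] KoszulHomology f i :=
  Submodule.mkQ _

theorem koszulClass_surjective (f : Fin n → R) (i : ℕ) : Surjective (koszulClass f i) :=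
  Submodule.mkQ_surjective _

theorem koszulClass_eq_zero_iff {f : Fin n → R} {i : ℕ} {z : koszulCycles f i} :
    koszulClass f i z = 0 ↔ ∃ u ∈ ⋀[R]^(i + 1) (Fin n → R), koszulDifferential f u = z :=
  Submodule.Quotient.mk_eq_zero _

/-- A family `f'` extends the family `f` by the element `a`, along the extension `S` of free
modules. -/
structure ExtendsFamily (S : RankOneExtension R (Fin n → R) (Fin n' → R)) (f : Fin n → R) (a : R)
    (f' : Fin n' → R) : Prop where
  comp_inc : Fintype.linearCombination R f' ∘ₗ S.inc = Fintype.linearCombination R f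
  apply_e : Fintype.linearCombination R f' S.e = a

variable {S : RankOneExtension R (Fin n → R) (Fin n' → R)} {f : Fin n → R} {a : R}
  {f' : Fin n' → R}

namespace ExtendsFamily

theorem d_incl (h : ExtendsFamily S f a f') (x : ExteriorAlgebra R (Fin n → R)) :
    koszulDifferential f' (S.incl x) = S.incl (koszulDifferential f x) := by
  rw [koszulDifferential_eq_extContract, S.extContract_incl, h.comp_inc]; rfl

theorem d_wedge (h : ExtendsFamily S f a f') (x : ExteriorAlgebra R (Fin n → R)) :
    koszulDifferential f' (S.wedge x) = a • S.incl x - S.wedge (koszulDifferential f x) := by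
  rw [koszulDifferential_eq_extContract, S.extContract_wedge, h.comp_inc, h.apply_e]; rfl

theorem proj_d (h : ExtendsFamily S f a f') (x : ExteriorAlgebra R (Fin n' → R)) :
    S.proj (koszulDifferential f' x) = koszulDifferential f (S.proj x) + a • S.coef x := by
  rw [koszulDifferential_eq_extContract, RankOneExtension.proj_extContract, h.comp_inc, h.apply_e]
  rfl

theorem coef_d (h : ExtendsFamily S f a f') (x : ExteriorAlgebra R (Fin n' → R)) :
    S.coef (koszulDifferential f' x) = - koszulDifferential f (S.coef x) := by
  rw [koszulDifferential_eq_extContract, RankOneExtension.coef_extContract, h.comp_inc]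
  rfl

theorem incl_mem_cycles (h : ExtendsFamily S f a f') {i : ℕ} {z : ExteriorAlgebra R (Fin n → R)}
    (hz : z ∈ koszulCycles f i) : S.incl z ∈ koszulCycles f' i := by
  refine ⟨RankOneExtension.incl_mem hz.1, ?_⟩
  rw [SetLike.mem_coe, LinearMap.mem_ker, h.d_incl, LinearMap.mem_ker.1 hz.2, map_zero]

theorem coef_mem_cycles (h : ExtendsFamily S f a f') {i : ℕ} {z : ExteriorAlgebra R (Fin n' → R)}
    (hz : z ∈ koszulCycles f' (i + 1)) : S.coef z ∈ koszulCycles f i := by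
  refine ⟨RankOneExtension.coef_mem hz.1, ?_⟩
  rw [SetLike.mem_coe, LinearMap.mem_ker, ← neg_eq_zero, ← h.coef_d, LinearMap.mem_ker.1 hz.2, map_zero]

/-- The map on Koszul homology induced by the inclusion of Koszul complexes. -/
def inclHomology (h : ExtendsFamily S f a f') (i : ℕ) :
    KoszulHomology f i →ₗ[R] KoszulHomology f' i :=
  Submodule.mapQ _ _ (S.incl.restrict (p := koszulCycles f i) (q := koszulCycles f' i)
    fun _ hz => h.incl_mem_cycles hz) <| by
    rintro z ⟨u, hu, huz⟩
    refine ⟨S.incl u, RankOneExtension.incl_mem hu, ?_⟩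
    rw [h.d_incl, huz]
    rfl

/-- The map on Koszul homology induced by the projection from the Koszul complex of the extended
family to the shifted Koszul complex of the original family. -/
def coefHomology (h : ExtendsFamily S f a f') (i : ℕ) :
    KoszulHomology f' (i + 1) →ₗ[R] KoszulHomology f i :=
  Submodule.mapQ _ _ (S.coef.restrict (p := koszulCycles f' (i + 1)) (q := koszulCycles f i)
    fun _ hz => h.coef_mem_cycles hz) <| by
    rintro z ⟨u, hu, huz⟩
    refine ⟨-S.coef u, neg_mem (RankOneExtension.coef_mem hu), ?_⟩
    rw [map_neg, ← h.coef_d, huz]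
    rfl

theorem inclHomology_koszulClass (h : ExtendsFamily S f a f') (i : ℕ) (z : koszulCycles f i) :
    h.inclHomology i (koszulClass f i z) =
      koszulClass f' i ⟨S.incl z, h.incl_mem_cycles z.2⟩ := rfl

theorem coefHomology_koszulClass (h : ExtendsFamily S f a f') (i : ℕ)
    (z : koszulCycles f' (i + 1)) :
    h.coefHomology i (koszulClass f' (i + 1) z) =
      koszulClass f i ⟨S.coef z, h.coef_mem_cycles z.2⟩ := rfl

theorem inclHomology_eq_zero_iff (h : ExtendsFamily S f a f') (i : ℕ) (z : KoszulHomology f i) :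
    h.inclHomology i z = 0 ↔ ∃ y, a • y = z := by
  constructor
  · obtain ⟨z, rfl⟩ := koszulClass_surjective f i z
    rw [h.inclHomology_koszulClass, koszulClass_eq_zero_iff]
    rintro ⟨u, hu, huz⟩
    have h1 : koszulDifferential f (S.proj u) + a • S.coef u = z := by
      rw [← h.proj_d, huz, S.proj_incl]
    have h2 : koszulDifferential f (S.coef u) = 0 := by
      rw [← neg_eq_zero, ← h.coef_d, huz, S.coef_incl]
    refine ⟨koszulClass f i ⟨S.coef u, RankOneExtension.coef_mem hu, h2⟩, ?_⟩
    rw [← sub_eq_zero, ← map_smul, ← map_sub, koszulClass_eq_zero_iff]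
    refine ⟨-S.proj u, neg_mem (RankOneExtension.proj_mem hu), ?_⟩
    simp [← h1]
  · rintro ⟨y, rfl⟩
    obtain ⟨y, rfl⟩ := koszulClass_surjective f i y
    rw [← map_smul, h.inclHomology_koszulClass, koszulClass_eq_zero_iff]
    refine ⟨S.wedge y, RankOneExtension.wedge_mem y.2.1, ?_⟩
    rw [h.d_wedge, LinearMap.mem_ker.1 y.2.2]
    simp

theorem exists_coefHomology_eq_iff (h : ExtendsFamily S f a f') (i : ℕ) (z : KoszulHomology f i) :
    (∃ y, h.coefHomology i y = z) ↔ a • z = 0 := by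
  constructor
  · rintro ⟨y, rfl⟩
    obtain ⟨y, rfl⟩ := koszulClass_surjective f' (i + 1) y
    rw [h.coefHomology_koszulClass, ← map_smul, koszulClass_eq_zero_iff]
    refine ⟨-S.proj y, neg_mem (RankOneExtension.proj_mem y.2.1), ?_⟩
    have := h.proj_d y
    rw [LinearMap.mem_ker.1 y.2.2, map_zero] at this
    rw [map_neg, neg_eq_iff_add_eq_zero]
    exact this.symm
  · obtain ⟨z, rfl⟩ := koszulClass_surjective f i z
    rw [← map_smul, koszulClass_eq_zero_iff]
    rintro ⟨u, hu, huz⟩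
    refine ⟨koszulClass f' (i + 1) ⟨S.wedge z - S.incl u,
      sub_mem (RankOneExtension.wedge_mem z.2.1) (RankOneExtension.incl_mem hu), ?_⟩, ?_⟩
    · rw [SetLike.mem_coe, LinearMap.mem_ker, map_sub, h.d_wedge, h.d_incl, huz, LinearMap.mem_ker.1 z.2.2]
      simp
    · rw [h.coefHomology_koszulClass]
      congr 1
      ext1
      simp [S.coef_wedge, S.coef_incl]

theorem exact_inclHomology_coefHomology (h : ExtendsFamily S f a f') (i : ℕ) :
    Exact (h.inclHomology (i + 1)) (h.coefHomology i) := by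
  intro x
  constructor
  · obtain ⟨x, rfl⟩ := koszulClass_surjective f' (i + 1) x
    rw [h.coefHomology_koszulClass, koszulClass_eq_zero_iff]
    rintro ⟨w, hw, hwx : koszulDifferential f w = S.coef x⟩
    have hx := S.incl_proj_add_wedge_coef (x : ExteriorAlgebra R (Fin n' → R))
    refine ⟨koszulClass f (i + 1) ⟨S.proj x + a • w, add_mem (RankOneExtension.proj_mem x.2.1)
      (Submodule.smul_mem _ _ hw), ?_⟩, ?_⟩
    · rw [SetLike.mem_coe, LinearMap.mem_ker, map_add, map_smul, hwx, ← h.proj_d, LinearMap.mem_ker.1 x.2.2,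
        map_zero]
    · rw [h.inclHomology_koszulClass, ← sub_eq_zero, ← map_sub, koszulClass_eq_zero_iff]
      refine ⟨S.wedge w, RankOneExtension.wedge_mem hw, (h.d_wedge w).trans ?_⟩
      change _ = S.incl (S.proj x + a • w) - (x : ExteriorAlgebra R (Fin n' → R))
      rw [hwx, map_add, map_smul, eq_sub_iff_add_eq]
      nth_rw 2 [← hx]
      abel
  · rintro ⟨z, rfl⟩
    obtain ⟨z, rfl⟩ := koszulClass_surjective f (i + 1) z
    rw [h.inclHomology_koszulClass, h.coefHomology_koszulClass, koszulClass_eq_zero_iff]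
    exact ⟨0, zero_mem _, by simp [S.coef_incl]⟩

theorem inclHomology_zero_surjective (h : ExtendsFamily S f a f') :
    Surjective (h.inclHomology 0) := by
  intro x
  obtain ⟨⟨x, hx⟩, rfl⟩ := koszulClass_surjective f' 0 x
  have hx' := hx.1
  rw [ExteriorAlgebra.exteriorPower, pow_zero] at hx'
  obtain ⟨r, rfl⟩ := Submodule.mem_one.1 hx'
  refine ⟨koszulClass f 0 ⟨algebraMap R _ r, ?_, ?_⟩, ?_⟩
  · rw [ExteriorAlgebra.exteriorPower, pow_zero]
    exact Submodule.mem_one.2 ⟨r, rfl⟩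
  · exact extContract_algebraMap _ r
  · rw [h.inclHomology_koszulClass]
    congr 1
    ext1
    simp [RankOneExtension.incl]

end ExtendsFamily

theorem smul_koszulHomology_eq_zero {f : Fin n → R} {a : R} (ha : a ∈ Ideal.span (Set.range f))
    (i : ℕ) (z : KoszulHomology f i) : a • z = 0 := by
  obtain ⟨v, rfl⟩ := (Ideal.mem_span_range_iff_exists_fun).1 ha
  obtain ⟨z, rfl⟩ := koszulClass_surjective f i z
  rw [← map_smul, koszulClass_eq_zero_iff]
  refine ⟨ExteriorAlgebra.ι R v * z, ExteriorAlgebra.ι_mul_mem_exteriorPower v i z.2.1, ?_⟩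
  rw [koszulDifferential_ι_mul, LinearMap.mem_ker.1 z.2.2]
  simp

theorem ExtendsFamily.exists_rightInverse_coefHomology (h : ExtendsFamily S f a f')
    (ha : a ∈ Ideal.span (Set.range f)) (i : ℕ) :
    ∃ s : KoszulHomology f i →ₗ[R] KoszulHomology f' (i + 1), h.coefHomology i ∘ₗ s = .id := by
  obtain ⟨v, hv⟩ := (Ideal.mem_span_range_iff_exists_fun).1 ha
  -- The section is left multiplication by the cycle `e - v`, where `v` is a preimage of `a`.
  let m : ExteriorAlgebra R (Fin n → R) →ₗ[R] ExteriorAlgebra R (Fin n' → R) :=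
    S.wedge - S.incl ∘ₗ LinearMap.mulLeft R (ExteriorAlgebra.ι R v)
  have hm (x) : m x = S.wedge x - S.incl (ExteriorAlgebra.ι R v * x) := rfl
  have hmd (x) : koszulDifferential f' (m x) = - m (koszulDifferential f x) := by
    rw [hm, hm, map_sub, h.d_wedge, h.d_incl, koszulDifferential_ι_mul, hv]
    simp only [map_sub, map_smul]
    abel
  have hmem (i : ℕ) (x) (hx : x ∈ ⋀[R]^i (Fin n → R)) : m x ∈ ⋀[R]^(i + 1) (Fin n' → R) :=
    sub_mem (RankOneExtension.wedge_mem hx)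
      (RankOneExtension.incl_mem (ExteriorAlgebra.ι_mul_mem_exteriorPower v i hx))
  have hcyc (x) (hx : x ∈ koszulCycles f i) : m x ∈ koszulCycles f' (i + 1) := by
    refine ⟨hmem i x hx.1, ?_⟩
    rw [SetLike.mem_coe, LinearMap.mem_ker, hmd, LinearMap.mem_ker.1 hx.2, map_zero, neg_zero]
  refine ⟨Submodule.mapQ _ _ (m.restrict hcyc) ?_, ?_⟩
  · rintro z ⟨u, hu, huz⟩
    refine ⟨-m u, neg_mem (hmem _ _ hu), ?_⟩
    rw [map_neg, hmd, huz, neg_neg]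
    rfl
  · ext x
    change koszulClass f i ⟨S.coef (m x), _⟩ = koszulClass f i x
    congr 1
    ext1
    simp [hm, S.coef_wedge, S.coef_incl]

/-- `H_0(f)` is the quotient of `R` by the ideal generated by `f`. -/
def koszulHomologyZeroEquiv (f : Fin n → R) :
    (R ⧸ Ideal.span (Set.range f)) ≃ₗ[R] KoszulHomology f 0 := by
  have h1 (r : R) : algebraMap R (ExteriorAlgebra R (Fin n → R)) r ∈ koszulCycles f 0 := by
    refine ⟨?_, extContract_algebraMap _ r⟩
    rw [ExteriorAlgebra.exteriorPower, pow_zero]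
    exact Submodule.mem_one.2 ⟨r, rfl⟩
  let g : R →ₗ[R] KoszulHomology f 0 := koszulClass f 0 ∘ₗ
    (Algebra.linearMap R (ExteriorAlgebra R (Fin n → R))).codRestrict _ h1
  have hg : Surjective g := by
    refine (koszulClass_surjective f 0).comp ?_
    rintro ⟨x, hx⟩
    have hx' := hx.1
    rw [ExteriorAlgebra.exteriorPower, pow_zero] at hx'
    obtain ⟨r, rfl⟩ := Submodule.mem_one.1 hx'
    exact ⟨r, rfl⟩
  refine (Submodule.quotEquivOfEq _ _ ?_).trans (g.quotKerEquivOfSurjective hg)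
  ext r
  rw [LinearMap.mem_ker, Ideal.mem_span_range_iff_exists_fun]
  change _ ↔ koszulClass f 0 ⟨algebraMap R _ r, h1 r⟩ = 0
  have h2 (v : Fin n → R) : koszulDifferential f (ExteriorAlgebra.ι R v) =
      algebraMap R _ (∑ i, v i * f i) := by
    rw [← mul_one (ExteriorAlgebra.ι R v), koszulDifferential_ι_mul,
      ← map_one (algebraMap R (ExteriorAlgebra R (Fin n → R))), koszulDifferential_eq_extContract,
      extContract_algebraMap, mul_zero, sub_zero, Algebra.algebraMap_eq_smul_one (∑ i, _), map_one]
  rw [koszulClass_eq_zero_iff]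
  constructor
  · rintro ⟨v, rfl⟩
    refine ⟨ExteriorAlgebra.ι R v, ?_, h2 v⟩
    rw [zero_add, ExteriorAlgebra.exteriorPower, pow_one]
    exact LinearMap.mem_range_self _ v
  · rintro ⟨u, hu, hur⟩
    rw [zero_add, ExteriorAlgebra.exteriorPower, pow_one] at hu
    obtain ⟨v, rfl⟩ := hu
    exact ⟨v, (ExteriorAlgebra.algebraMap_inj _ _ _).1 ((h2 v).symm.trans hur)⟩

/-- A family indexed by `Fin n'` extends its restriction along an injection `Fin n → Fin n'` that
misses exactly the index `k`. -/
theorem exists_extendsFamily {j : Fin n → Fin n'} (hj : Injective j) (k : Fin n')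
    (hk : ∀ l, l ∈ Set.range j ↔ l ≠ k) (f' : Fin n' → R) :
    ∃ S : RankOneExtension R (Fin n → R) (Fin n' → R), ExtendsFamily S (f' ∘ j) (f' k) f' := by
  have hjk (i) : j i ≠ k := (hk _).1 ⟨i, rfl⟩
  refine ⟨{ inc := Function.ExtendByZero.linearMap R j
            pr := LinearMap.funLeft R R j
            e := Pi.single k 1
            δ := LinearMap.proj k
            pr_inc := ?_
            δ_inc := ?_
            pr_e := ?_
            δ_e := ?_
            decomp := ?_ }, ?_, ?_⟩
  · ext v i
    simp [LinearMap.funLeft, hj.extend_apply]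
  · ext v
    have : ¬∃ i, j i = k := fun ⟨i, hi⟩ => hjk i hi
    simp [Function.extend_apply' _ _ _ this]
  · ext i
    simp [LinearMap.funLeft, hjk]
  · simp
  · intro v
    ext l
    by_cases hl : l = k
    · subst hl
      have : ¬∃ i, j i = l := fun ⟨i, hi⟩ => hjk i hi
      simp [Function.extend_apply' _ _ _ this]
    · obtain ⟨i, rfl⟩ := (hk l).2 hl
      simp [hj.extend_apply, hl, LinearMap.funLeft]
  · refine LinearMap.pi_ext' fun i => LinearMap.ext_ring ?_
    have h1 : Function.ExtendByZero.linearMap R j (Pi.single i (1 : R)) = Pi.single (j i) 1 := by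
      ext l
      rw [Function.ExtendByZero.linearMap_apply]
      by_cases hl : l = k
      · subst hl
        have : ¬∃ i, j i = l := fun ⟨i, hi⟩ => hjk i hi
        simp [Function.extend_apply' _ _ _ this, (hjk i).symm]
      · obtain ⟨i', rfl⟩ := (hk l).2 hl
        simp [hj.extend_apply, Pi.single_apply, hj.eq_iff]
    simp [h1]
  · simp

end KoszulSequence

/-! ### Regular sequences on Koszul homology under a change of generators -/

theorem Fin.range_append {α : Type*} {m n : ℕ} (g : Fin m → α) (f : Fin n → α) :
    Set.range (Fin.append g f) = Set.range g ∪ Set.range f := by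
  ext x
  constructor
  · rintro ⟨p, rfl⟩
    induction p using Fin.addCases <;> simp
  · rintro (⟨p, rfl⟩ | ⟨p, rfl⟩)
    exacts [⟨Fin.castAdd n p, by simp⟩, ⟨Fin.natAdd m p, by simp⟩]

section KoszulRegular

open Function RingTheory.Sequence

variable {R : Type*} [CommRing R] {n n' : ℕ}

/-- For every `i`, the first `D - n + i` elements of the list `w` form a weakly regular sequence
on `H_i(f_1, …, f_n)`; the truncated subtraction gives the empty sequence if `D + i < n`. -/
def IsKoszulRegular (w : List R) (D : ℕ) (f : Fin n → R) : Prop :=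
  ∀ i : ℕ, IsWeaklyRegular (KoszulHomology f i) (w.take (D + i - n))

variable {S : RankOneExtension R (Fin n → R) (Fin n' → R)} {f : Fin n → R} {a : R}
  {f' : Fin n' → R}

theorem ExtendsFamily.inclHomology_injective (h : ExtendsFamily S f a f') {i : ℕ}
    (ha : ∀ z : KoszulHomology f i, a • z = 0) : Injective (h.inclHomology i) := by
  rw [← LinearMap.ker_eq_bot, LinearMap.ker_eq_bot']
  intro z hz
  obtain ⟨y, rfl⟩ := (h.inclHomology_eq_zero_iff i z).1 hz
  exact ha y

theorem IsKoszulRegular.extend_of_mem (h : ExtendsFamily S f a f') (hn : n' = n + 1)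
    (ha : a ∈ Ideal.span (Set.range f)) {w : List R} {D : ℕ} (hf : IsKoszulRegular w D f) :
    IsKoszulRegular w D f' := by
  rintro (_ | i)
  · let e := LinearEquiv.ofBijective (h.inclHomology 0)
      ⟨h.inclHomology_injective (smul_koszulHomology_eq_zero ha 0),
        h.inclHomology_zero_surjective⟩
    exact (e.isWeaklyRegular_congr _).1 ((hf 0).take_of_le (by omega))
  · obtain ⟨s, hs⟩ := h.exists_rightInverse_coefHomology ha i
    refine isWeaklyRegular_middle_of_exact _
      (h.inclHomology_injective (smul_koszulHomology_eq_zero ha (i + 1)))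
      (h.exact_inclHomology_coefHomology i) (fun z => ⟨s z, LinearMap.congr_fun hs z⟩)
      ((hf (i + 1)).take_of_le (by omega)) ((hf i).take_of_le (by omega))

theorem IsKoszulRegular.restrict_of_mem (h : ExtendsFamily S f a f') (hn : n' = n + 1)
    (ha : a ∈ Ideal.span (Set.range f)) {w : List R} {D : ℕ} (hf : IsKoszulRegular w D f') :
    IsKoszulRegular w D f := by
  intro i
  obtain ⟨s, hs⟩ := h.exists_rightInverse_coefHomology ha i
  exact IsWeaklyRegular.of_leftInverse _ hs ((hf (i + 1)).take_of_le (by omega))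

theorem IsKoszulRegular.extend_of_cons (h : ExtendsFamily S f a f') (hn : n' = n + 1)
    {w : List R} {D : ℕ} (hD : n < D) (hf : IsKoszulRegular (a :: w) D f) :
    IsKoszulRegular w D f' := by
  have hf' (i : ℕ) : IsWeaklyRegular (KoszulHomology f i) (a :: w.take (D + i - n')) := by
    have := hf i
    rwa [show D + i - n = (D + i - n') + 1 by omega, List.take_succ_cons] at this
  intro i
  have hs : Surjective (h.inclHomology i) := by
    cases i with
    | zero => exact h.inclHomology_zero_surjective
    | succ i =>
      intro y
      refine (h.exact_inclHomology_coefHomology i y).1 ?_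
      exact ((isWeaklyRegular_cons_iff _ _ _).1 (hf' i)).1.right_eq_zero_of_smul
        ((h.exists_coefHomology_eq_iff i _).1 ⟨y, rfl⟩)
  exact (isWeaklyRegular_quotSMulTop_iff hs (h.inclHomology_eq_zero_iff i) _).1
    ((isWeaklyRegular_cons_iff _ _ _).1 (hf' i)).2

theorem subsingleton_koszulHomology_extend (h : ExtendsFamily S f a f')
    (hf : ∀ i, Subsingleton (KoszulHomology f (i + 1)))
    (ha : IsSMulRegular (R ⧸ Ideal.span (Set.range f)) a) (i : ℕ) :
    Subsingleton (KoszulHomology f' (i + 1)) := by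
  refine subsingleton_of_forall_eq 0 fun y => ?_
  have hy : h.coefHomology i y = 0 := by
    have h1 := (h.exists_coefHomology_eq_iff i _).1 ⟨y, rfl⟩
    cases i with
    | zero => exact (((koszulHomologyZeroEquiv f).isSMulRegular_congr a).1 ha).right_eq_zero_of_smul h1
    | succ i => exact @Subsingleton.elim _ (hf i) _ _
  obtain ⟨z, rfl⟩ := (h.exact_inclHomology_coefHomology i y).1 hy
  rw [@Subsingleton.elim _ (hf i) z 0, map_zero]

theorem subsingleton_koszulHomology_of_isEmpty (f : Fin 0 → R) (i : ℕ) :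
    Subsingleton (KoszulHomology f (i + 1)) := by
  refine subsingleton_of_forall_eq 0 fun y => ?_
  obtain ⟨⟨y, hy⟩, rfl⟩ := koszulClass_surjective f (i + 1) y
  have h0 : LinearMap.range (ExteriorAlgebra.ι R : (Fin 0 → R) →ₗ[R] _) = ⊥ := by
    rw [LinearMap.range_eq_bot]
    ext i
    exact i.elim0
  have hy' := hy.1
  rw [ExteriorAlgebra.exteriorPower, h0, pow_succ, Submodule.mul_bot] at hy'
  rw [koszulClass_eq_zero_iff]
  exact ⟨0, zero_mem _, by rw [map_zero]; exact ((Submodule.mem_bot R).1 hy').symm⟩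

theorem isKoszulRegular_of_span_eq_top {f : Fin n → R} (hf : Ideal.span (Set.range f) = ⊤)
    (w : List R) (D : ℕ) : IsKoszulRegular w D f := by
  intro i
  have : Subsingleton (KoszulHomology f i) := by
    refine subsingleton_of_forall_eq 0 fun z => ?_
    rw [← one_smul R z]
    exact smul_koszulHomology_eq_zero (hf ▸ Submodule.mem_top) i z
  exact isWeaklyRegular_of_subsingleton _

theorem IsKoszulRegular.comp_cast {f : Fin n → R} {w : List R} {D : ℕ}
    (hf : IsKoszulRegular w D f) (h : n' = n) : IsKoszulRegular w D (f ∘ Fin.cast h) := by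
  subst h
  exact hf

theorem exists_extendsFamily_castSucc (f : Fin (n + 1) → R) :
    ∃ S, ExtendsFamily S (f ∘ Fin.castSucc) (f (Fin.last n)) f :=
  exists_extendsFamily (Fin.castSucc_injective n) (Fin.last n)
    (fun l => by rw [Fin.range_castSucc]; simp [Fin.ext_iff]; omega) f

theorem exists_extendsFamily_succ (f : Fin (n + 1) → R) :
    ∃ S, ExtendsFamily S (f ∘ Fin.succ) (f 0) f :=
  exists_extendsFamily (Fin.succ_injective n) 0
    (fun l => by rw [Fin.range_succ]; simp) f

theorem exists_extendsFamily_append {m : ℕ} (g : Fin (m + 1) → R) (f : Fin n → R) :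
    ∃ S, ExtendsFamily S (Fin.append (g ∘ Fin.castSucc) f) (g (Fin.last m)) (Fin.append g f) := by
  let j : Fin (m + n) → Fin (m + 1 + n) :=
    Fin.append (fun i => Fin.castAdd n i.castSucc) (Fin.natAdd (m + 1))
  have hj1 (i : Fin m) : j (Fin.castAdd n i) = Fin.castAdd n i.castSucc := by simp [j]
  have hj2 (i : Fin n) : j (Fin.natAdd m i) = Fin.natAdd (m + 1) i := by simp [j]
  have hj : Injective j := by
    intro p q hpq
    induction p using Fin.addCases <;> induction q using Fin.addCases <;>
      simp only [hj1, hj2, Fin.ext_iff, Fin.val_castAdd, Fin.val_natAdd, Fin.val_castSucc] at hpq ⊢ <;>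
      omega
  obtain ⟨S, hS⟩ := exists_extendsFamily hj (Fin.castAdd n (Fin.last m)) (fun l => by
    constructor
    · rintro ⟨p, rfl⟩
      induction p using Fin.addCases <;>
        simp only [hj1, hj2, ne_eq, Fin.ext_iff, Fin.val_castAdd, Fin.val_natAdd,
          Fin.val_castSucc, Fin.val_last] <;> omega
    · intro hl
      induction l using Fin.addCases with
      | left l =>
        obtain ⟨i, rfl⟩ := Fin.exists_castSucc_eq.2 (fun h : l = Fin.last m => hl (h ▸ rfl))
        exact ⟨Fin.castAdd n i, hj1 i⟩
      | right l => exact ⟨Fin.natAdd m l, hj2 l⟩) (Fin.append g f)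
  refine ⟨S, ?_⟩
  convert hS using 1
  · ext p
    induction p using Fin.addCases <;> simp [hj1, hj2]
  · simp

theorem IsKoszulRegular.append_right {m : ℕ} {g : Fin m → R} {w : List R} {D : ℕ}
    (hg : IsKoszulRegular w D g) (f : Fin n → R)
    (hf : ∀ i, f i ∈ Ideal.span (Set.range g)) : IsKoszulRegular w D (Fin.append g f) := by
  induction n with
  | zero =>
    rw [Subsingleton.elim f Fin.elim0, Fin.append_elim0]
    exact hg.comp_cast (Nat.add_zero m)
  | succ n ih =>
    let F : Fin (m + n + 1) → R := Fin.append (m := m) (n := n + 1) g f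
    let f₀ : Fin n → R := fun i => f i.castSucc
    have hF : F ∘ Fin.castSucc (n := m + n) = Fin.append g f₀ := by
      ext p
      induction p using Fin.addCases with
      | left i => exact (Fin.append_left g f i).trans (Fin.append_left g f₀ i).symm
      | right i => exact (Fin.append_right g f i.castSucc).trans (Fin.append_right g f₀ i).symm
    have hlast : F (Fin.last (m + n)) = f (Fin.last n) := Fin.append_right g f (Fin.last n)
    obtain ⟨S, hS⟩ := exists_extendsFamily_castSucc F
    rw [hF, hlast] at hS
    refine IsKoszulRegular.extend_of_mem hS rfl ?_ (ih f₀ fun i => hf _)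
    exact Ideal.span_mono (Fin.range_append g f₀ ▸ Set.subset_union_left) (hf _)

theorem IsKoszulRegular.of_append {m : ℕ} {g : Fin m → R} {w : List R} {D : ℕ}
    {f : Fin n → R} (hg : ∀ i, g i ∈ Ideal.span (Set.range f))
    (h : IsKoszulRegular w D (Fin.append g f)) : IsKoszulRegular w D f := by
  induction m with
  | zero =>
    have := h.comp_cast (Nat.zero_add n).symm
    convert this
    rw [Subsingleton.elim g Fin.elim0, Fin.elim0_append]
    rfl
  | succ m ih =>
    obtain ⟨S, hS⟩ := exists_extendsFamily_append g f
    refine ih (g := g ∘ Fin.castSucc) (fun i => hg _) (h.restrict_of_mem hS (by omega) ?_)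
    exact Ideal.span_mono (Fin.range_append _ f ▸ Set.subset_union_right) (hg _)

/-- The depth estimate for Koszul homology does not depend on the choice of generators: one
generating family is transformed into another by adding and removing redundant generators. -/
theorem IsKoszulRegular.of_span_eq {m : ℕ} {g : Fin m → R} {f : Fin n → R} {w : List R} {D : ℕ}
    (hg : IsKoszulRegular w D g) (h : Ideal.span (Set.range f) = Ideal.span (Set.range g)) :
    IsKoszulRegular w D f :=
  (hg.append_right f fun i => h ▸ Ideal.subset_span ⟨i, rfl⟩).of_append
    fun i => h ▸ Ideal.subset_span ⟨i, rfl⟩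

end KoszulRegular

/-! ### Regular sequences of variables, and ideals of the form `x J` -/

section Variables

open Function RingTheory.Sequence MvPolynomial

variable {k : Type*} [Field k] {σ : Type*}

theorem isSMulRegular_X_quotient_span_X {s : Set σ} {j : σ} (hj : j ∉ s) :
    IsSMulRegular (MvPolynomial σ k ⧸ Ideal.span (X '' s : Set (MvPolynomial σ k)))
      (X j : MvPolynomial σ k) := by
  rw [isSMulRegular_quotient_iff_mem_of_smul_mem]
  intro x hx
  rw [mem_ideal_span_X_image] at hx ⊢
  intro m hm
  obtain ⟨i, hi, hmi⟩ := hx (m + Finsupp.single j 1) (by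
    rw [mem_support_iff] at hm ⊢
    rwa [smul_eq_mul, mul_comm, coeff_mul_X])
  refine ⟨i, hi, ?_⟩
  have hij : j ≠ i := fun h => hj (h ▸ hi)
  simpa [hij] using hmi

theorem isWeaklyRegular_X_quotient_span_X (zs : List σ) (hz : zs.Nodup) {s : Set σ}
    (hs : ∀ i ∈ zs, i ∉ s) :
    IsWeaklyRegular (MvPolynomial σ k ⧸ Ideal.span (X '' s : Set (MvPolynomial σ k)))
      (zs.map (X : σ → MvPolynomial σ k)) := by
  induction zs generalizing s with
  | nil => exact .nil _ _
  | cons j zs ih =>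
    rw [List.map_cons, isWeaklyRegular_cons_iff]
    refine ⟨isSMulRegular_X_quotient_span_X (hs j (by simp)), ?_⟩
    have hle : Ideal.span (X '' s : Set (MvPolynomial σ k)) ≤ Ideal.span (X '' (insert j s)) :=
      Ideal.span_mono (Set.image_mono (Set.subset_insert j s))
    refine (isWeaklyRegular_quotSMulTop_iff (g := Submodule.factor hle)
      (Submodule.factor_surjective hle) ?_ _).2 (ih hz.of_cons ?_)
    · intro z
      obtain ⟨z, rfl⟩ := Submodule.mkQ_surjective _ z
      rw [Submodule.factor_mk]
      simp only [Submodule.mkQ_apply]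
      rw [Submodule.Quotient.mk_eq_zero, Set.image_insert_eq,
        Ideal.mem_span_insert]
      constructor
      · rintro ⟨a, b, hb, rfl⟩
        refine ⟨Submodule.Quotient.mk a, ?_⟩
        rw [← Submodule.Quotient.mk_smul, Submodule.Quotient.eq, ← neg_mem_iff]
        convert hb using 1
        simp only [smul_eq_mul]
        ring
      · rintro ⟨y, hy⟩
        obtain ⟨y, rfl⟩ := Submodule.mkQ_surjective _ y
        rw [Submodule.mkQ_apply, ← Submodule.Quotient.mk_smul, Submodule.Quotient.eq,
          ← neg_mem_iff] at hy
        refine ⟨y, _, hy, ?_⟩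
        simp only [smul_eq_mul]
        ring
    · intro i hi
      rintro (rfl | h)
      · exact (List.nodup_cons.1 hz).1 hi
      · exact hs i (List.mem_cons_of_mem _ hi) h

end Variables

section Domain

open Function RingTheory.Sequence

variable {R : Type*} [CommRing R] [IsDomain R] {n : ℕ}

/-- From the exact sequence `0 → R/J → R/xJ → R/x → 0`, whose first map is multiplication
by `x`. -/
theorem isWeaklyRegular_quotient_span_singleton_mul {x : R} (hx : x ≠ 0) {J : Ideal R} {rs : List R}
    (hJ : IsWeaklyRegular (R ⧸ J) rs) (hxr : IsWeaklyRegular (R ⧸ Ideal.span {x}) rs) :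
    IsWeaklyRegular (R ⧸ Ideal.span {x} * J) rs := by
  let f : (R ⧸ J) →ₗ[R] (R ⧸ Ideal.span {x} * J) :=
    Submodule.mapQ _ _ (LinearMap.mulLeft R x) fun z hz =>
      Ideal.mul_mem_mul (Ideal.mem_span_singleton_self x) hz
  have hle : Ideal.span {x} * J ≤ Ideal.span {x} := Ideal.mul_le_left
  have hfmk (z : R) : f (Submodule.Quotient.mk z) = Submodule.Quotient.mk (x * z) := rfl
  refine isWeaklyRegular_middle_of_exact rs (f := f) (g := Submodule.factor hle) ?_ ?_
    (Submodule.factor_surjective hle) hJ hxr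
  · rw [← LinearMap.ker_eq_bot, LinearMap.ker_eq_bot']
    intro z hz
    obtain ⟨z, rfl⟩ := Submodule.mkQ_surjective _ z
    rw [Submodule.mkQ_apply, hfmk, Submodule.Quotient.mk_eq_zero, Ideal.mem_span_singleton_mul] at hz
    obtain ⟨w, hw, hwz⟩ := hz
    rw [Submodule.mkQ_apply, Submodule.Quotient.mk_eq_zero, ← mul_left_cancel₀ hx hwz]
    exact hw
  · intro z
    obtain ⟨z, rfl⟩ := Submodule.mkQ_surjective _ z
    rw [Submodule.factor_mk]
    simp only [Submodule.mkQ_apply]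
    rw [Submodule.Quotient.mk_eq_zero, Ideal.mem_span_singleton']
    constructor
    · rintro ⟨a, rfl⟩
      exact ⟨Submodule.Quotient.mk a, (hfmk a).trans (congrArg _ (mul_comm x a))⟩
    · rintro ⟨y, hy⟩
      obtain ⟨y, rfl⟩ := Submodule.mkQ_surjective _ y
      rw [Submodule.mkQ_apply, hfmk, Submodule.Quotient.eq] at hy
      obtain ⟨a, ha⟩ := Ideal.mem_span_singleton'.1 (hle hy)
      exact ⟨y - a, by rw [sub_mul, ha]; ring⟩

/-- The annihilator of `xy` in `R/xJ` is `J/xJ` if `y` is regular modulo `J`. -/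
theorem isWeaklyRegular_torsion_quotient_mul {x y : R} (hx : x ≠ 0) {J : Ideal R}
    (hy : IsSMulRegular (R ⧸ J) y) {rs : List R}
    (hJ : IsWeaklyRegular (R ⧸ J) rs) (hxr : IsWeaklyRegular (R ⧸ Ideal.span {x}) rs) :
    IsWeaklyRegular (LinearMap.ker (LinearMap.lsmul R (R ⧸ Ideal.span {x} * J) (x * y))) rs := by
  have hle : Ideal.span {x} * J ≤ J := Ideal.mul_le_right
  refine isWeaklyRegular_left_of_exact rs (f := Submodule.subtype _) (g := Submodule.factor hle)
    (Submodule.injective_subtype _) ?_ (Submodule.factor_surjective hle)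
    (isWeaklyRegular_quotient_span_singleton_mul hx hJ hxr) hJ
  rw [LinearMap.exact_iff, Submodule.range_subtype]
  ext z
  obtain ⟨z, rfl⟩ := Submodule.mkQ_surjective _ z
  rw [LinearMap.mem_ker, LinearMap.mem_ker, Submodule.factor_mk]
  simp only [Submodule.mkQ_apply]
  rw [Submodule.Quotient.mk_eq_zero, LinearMap.lsmul_apply, ← Submodule.Quotient.mk_smul,
    Submodule.Quotient.mk_eq_zero, Ideal.mem_span_singleton_mul]
  rw [isSMulRegular_quotient_iff_mem_of_smul_mem] at hy
  constructor
  · exact fun hz => ⟨y * z, J.mul_mem_left _ hz, by rw [smul_eq_mul]; ring⟩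
  · rintro ⟨w, hw, hwz⟩
    refine hy z ?_
    rw [smul_eq_mul, mul_assoc] at hwz
    rw [smul_eq_mul, ← mul_left_cancel₀ hx hwz]
    exact hw

theorem koszulDifferential_smul_family {R : Type*} [CommRing R] {n : ℕ} (x : R) (f : Fin n → R)
    (z : ExteriorAlgebra R (Fin n → R)) :
    koszulDifferential (x • f) z = x • koszulDifferential f z := by
  have : Fintype.linearCombination R (x • f) = x • Fintype.linearCombination R f := by
    ext i
    simp
  simp [koszulDifferential, this]

/-- The cycles for `x f` and `f` agree, while the boundaries get multiplied by `x`. -/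
theorem smul_koszulHomology_smul_family_eq_zero {x : R} (hx : x ≠ 0) {f : Fin n → R} {i : ℕ}
    (hf : Subsingleton (KoszulHomology f (i + 1))) (z : KoszulHomology (x • f) (i + 1)) :
    x • z = 0 := by
  obtain ⟨⟨z, hz⟩, rfl⟩ := koszulClass_surjective _ _ z
  have hd : koszulDifferential f z = 0 := by
    have h1 : x • (⟨koszulDifferential f z, koszulDifferential_mem f i hz.1⟩ :
        ⋀[R]^i (Fin n → R)) = 0 := by
      ext1
      exact (koszulDifferential_smul_family x f z).symm.trans (LinearMap.mem_ker.1 hz.2)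
    exact congrArg Subtype.val ((smul_eq_zero.1 h1).resolve_left hx)
  obtain ⟨u, hu, huz⟩ := koszulClass_eq_zero_iff.1
    (Subsingleton.elim (koszulClass f (i + 1) ⟨z, hz.1, hd⟩) 0)
  rw [← map_smul, koszulClass_eq_zero_iff]
  exact ⟨u, hu, by rw [koszulDifferential_smul_family, huz]; rfl⟩

theorem span_range_smul_family {R : Type*} [CommRing R] {n : ℕ} (x : R) (f : Fin n → R) :
    Ideal.span (Set.range (x • f)) = Ideal.span {x} * Ideal.span (Set.range f) := by
  rw [Ideal.span_mul_span', Set.singleton_mul, ← Set.range_comp]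
  rfl

end Domain

/-! ### Koszul homology of variables and of products with a fixed variable -/

section VariableFamilies

open Function RingTheory.Sequence MvPolynomial

variable {k : Type*} [Field k] {σ : Type*}

/-- The family of variables with indices in a list. -/
def varFamily (k : Type*) [Field k] (l : List σ) : Fin l.length → MvPolynomial σ k :=
  fun i => X (l.get i)

theorem range_varFamily (l : List σ) :
    Set.range (varFamily k l) = X '' {i | i ∈ l} := by
  rw [← Set.range_list_get l, ← Set.range_comp]
  rfl

theorem subsingleton_koszulHomology_varFamily {l : List σ} (hl : l.Nodup) (i : ℕ) :
    Subsingleton (KoszulHomology (varFamily k l) (i + 1)) := by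
  induction l generalizing i with
  | nil => exact subsingleton_koszulHomology_of_isEmpty _ i
  | cons y l ih =>
    obtain ⟨S, hS⟩ := exists_extendsFamily_succ (varFamily k (y :: l))
    refine subsingleton_koszulHomology_extend hS (fun i => ih hl.of_cons i) ?_ i
    change IsSMulRegular (_ ⧸ Ideal.span (Set.range (varFamily k l))) (X y : MvPolynomial σ k)
    rw [range_varFamily]
    exact isSMulRegular_X_quotient_span_X (List.nodup_cons.1 hl).1

theorem isWeaklyRegular_X_quotient_span_varFamily {l zs : List σ} (h : (zs ++ l).Nodup) :
    IsWeaklyRegular (MvPolynomial σ k ⧸ Ideal.span (Set.range (varFamily k l)))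
      (zs.map (X : σ → MvPolynomial σ k)) := by
  rw [range_varFamily]
  rw [List.nodup_append'] at h
  exact isWeaklyRegular_X_quotient_span_X zs h.1 fun i hi hi' => h.2.2 hi hi'

theorem isWeaklyRegular_X_quotient_span_singleton_X {r : σ} {zs : List σ}
    (h : (zs ++ [r]).Nodup) :
    IsWeaklyRegular (MvPolynomial σ k ⧸ Ideal.span {(X r : MvPolynomial σ k)})
      (zs.map (X : σ → MvPolynomial σ k)) := by
  have := isWeaklyRegular_X_quotient_span_varFamily (k := k) h
  have hs : {i | i ∈ [r]} = {r} := by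
    ext i
    simp
  rwa [range_varFamily, hs, Set.image_singleton] at this

/-- Induction on the number of variables: adding the generator `X_r X_y` to the family
`X_r X_r, X_r X_{y'}, …` turns each long exact sequence into a short one, because `X_r` kills the
positive Koszul homology. The cokernel in degree one is the annihilator of `X_r X_y` in `H_0`. -/
theorem isWeaklyRegular_koszulHomology_X_smul_varFamily (r : σ) (u : List (MvPolynomial σ k))
    (l zs : List σ) (h : (zs ++ (l ++ [r])).Nodup) (i : ℕ) :
    IsWeaklyRegular
      (KoszulHomology ((X r : MvPolynomial σ k) • varFamily k (l ++ [r])) (i + 1))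
      (((zs ++ l).map X ++ u).take (zs.length + (i + 1))) := by
  induction l generalizing zs i with
  | nil =>
    obtain ⟨S, hS⟩ := exists_extendsFamily_succ ((X r : MvPolynomial σ k) • varFamily k [r])
    have : Subsingleton (KoszulHomology ((X r : MvPolynomial σ k) • varFamily k [r]) (i + 1)) := by
      refine subsingleton_koszulHomology_extend hS (subsingleton_koszulHomology_of_isEmpty _) ?_ i
      have : IsEmpty (Fin ([] : List σ).length) := inferInstanceAs (IsEmpty (Fin 0))
      rw [isSMulRegular_quotient_iff_mem_of_smul_mem, Set.range_eq_empty, Ideal.span_empty]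
      intro x hx
      have hr : (X r : MvPolynomial σ k) ≠ 0 := X_ne_zero r
      change X r * X r * x = 0 at hx
      simpa [hr] using hx
    exact @isWeaklyRegular_of_subsingleton _ _ _ _ _ _ this
  | cons y l ih =>
    let f : Fin (l ++ [r]).length → MvPolynomial σ k :=
      (X r : MvPolynomial σ k) • varFamily k (l ++ [r])
    have hr : (X r : MvPolynomial σ k) ≠ 0 := X_ne_zero r
    have hnd : (l ++ [r]).Nodup := (List.nodup_append'.1 h).2.1.of_cons
    have hy : y ∉ l ++ [r] := (List.nodup_cons.1 (List.nodup_append'.1 h).2.1).1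
    have hzs : (zs ++ [y] ++ (l ++ [r])).Nodup := by simpa using h
    have hzr : (zs ++ [y] ++ [r]).Nodup := by
      refine hzs.sublist ?_
      exact List.Sublist.append_left (List.sublist_append_right l [r]) _
    have hkill (i : ℕ) (z : KoszulHomology f (i + 1)) :
        ((X r : MvPolynomial σ k) * X y) • z = 0 := by
      rw [mul_comm, mul_smul, smul_koszulHomology_smul_family_eq_zero hr
        (subsingleton_koszulHomology_varFamily hnd i), smul_zero]
    have hlist : (zs ++ y :: l).map (X : σ → MvPolynomial σ k) ++ u =
        ((zs ++ [y]) ++ l).map X ++ u := by simp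
    have ih' := fun i => ih (zs ++ [y]) hzs i
    rw [← hlist] at ih'
    simp only [List.length_append, List.length_singleton] at ih'
    obtain ⟨S, hS'⟩ := exists_extendsFamily_succ
      ((X r : MvPolynomial σ k) • varFamily k (y :: (l ++ [r])))
    have hS : ExtendsFamily S f ((X r : MvPolynomial σ k) * X y)
      ((X r : MvPolynomial σ k) • varFamily k (y :: (l ++ [r]))) := hS'
    cases i with
    | succ i =>
      refine isWeaklyRegular_middle_of_exact _ (hS.inclHomology_injective (hkill (i + 1)))
        (hS.exact_inclHomology_coefHomology (i + 1))
        (fun z => (hS.exists_coefHomology_eq_iff (i + 1) z).2 (hkill i z)) ?_ ?_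
      · exact (ih' (i + 1)).take_of_le (by omega)
      · exact (ih' i).take_of_le (by omega)
    | zero =>
      refine isWeaklyRegular_middle_of_exact _ (hS.inclHomology_injective (hkill 0))
        (g := (hS.coefHomology 0).rangeRestrict) ?_
        (LinearMap.surjective_rangeRestrict _) ((ih' 0).take_of_le (by omega)) ?_
      · intro x
        rw [← hS.exact_inclHomology_coefHomology 0 x, ← Subtype.coe_inj]
        rfl
      · have htake : ((zs ++ y :: l).map (X : σ → MvPolynomial σ k) ++ u).take
            (zs.length + (0 + 1)) = (zs ++ [y]).map X := by
          rw [hlist, List.map_append, List.append_assoc]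
          exact List.take_left' (by simp)
        rw [htake]
        have hyJ : IsSMulRegular (MvPolynomial σ k ⧸ Ideal.span (Set.range
            (varFamily k (l ++ [r])))) (X y : MvPolynomial σ k) := by
          rw [range_varFamily]
          exact isSMulRegular_X_quotient_span_X hy
        have hJ := span_range_smul_family (X r) (varFamily k (l ++ [r]))
        have hT := isWeaklyRegular_torsion_quotient_mul hr hyJ
          (isWeaklyRegular_X_quotient_span_varFamily (k := k) hzs)
          (isWeaklyRegular_X_quotient_span_singleton_X (k := k) hzr)
        let e := (Submodule.quotEquivOfEq _ _ hJ.symm).trans (koszulHomologyZeroEquiv f)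
        refine (LinearEquiv.isWeaklyRegular_congr
          ((e.submoduleMap _).trans (LinearEquiv.ofEq _ _ ?_)) _).1 hT
        ext z
        rw [LinearMap.mem_range, hS.exists_coefHomology_eq_iff 0 z, Submodule.mem_map]
        constructor
        · rintro ⟨w, hw, rfl⟩
          change _ • e w = 0
          rw [← map_smul]
          exact (congrArg e (LinearMap.mem_ker.1 hw)).trans (map_zero e)
        · intro hz
          refine ⟨e.symm z, ?_, e.apply_symm_apply z⟩
          rw [LinearMap.mem_ker, LinearMap.lsmul_apply, ← map_smul, hz, map_zero]

theorem isKoszulRegular_X_smul_varFamily (r : σ) (u : List (MvPolynomial σ k))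
    (l zs : List σ) (h : (zs ++ (l ++ [r])).Nodup) :
    IsKoszulRegular ((zs ++ l).map X ++ u) (zs.length + (l.length + 1))
      ((X r : MvPolynomial σ k) • varFamily k (l ++ [r])) := by
  intro i
  have hlen : zs.length + (l.length + 1) + i - (l ++ [r]).length = zs.length + i := by
    simp only [List.length_append, List.length_singleton]
    omega
  rw [hlen]
  cases i with
  | succ i => exact isWeaklyRegular_koszulHomology_X_smul_varFamily r u l zs h i
  | zero =>
    refine (LinearEquiv.isWeaklyRegular_congr (koszulHomologyZeroEquiv _) _).1 ?_
    rw [List.map_append, List.append_assoc, List.take_left' (by simp), span_range_smul_family]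
    refine isWeaklyRegular_quotient_span_singleton_mul (X_ne_zero r)
      (isWeaklyRegular_X_quotient_span_varFamily (k := k) h)
      (isWeaklyRegular_X_quotient_span_singleton_X (k := k) (h.sublist ?_))
    exact List.Sublist.append_left (List.sublist_append_right l [r]) _

theorem IsKoszulRegular.exists_append {R : Type*} [CommRing R] (q : List R) {w : List R} {D n : ℕ}
    {f : Fin n → R} (hD : n + q.length ≤ D) (h : IsKoszulRegular (q ++ w) D f) :
    ∃ (n' : ℕ) (f' : Fin n' → R), IsKoszulRegular w D f' ∧
      Ideal.span (Set.range f') = Ideal.span {x | x ∈ q} ⊔ Ideal.span (Set.range f) := by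
  induction q generalizing n f with
  | nil => exact ⟨n, f, h, by simp⟩
  | cons a q ih =>
    obtain ⟨S, hS⟩ := exists_extendsFamily_succ (Fin.cons a f : Fin (n + 1) → R)
    rw [List.length_cons] at hD
    have hS' : ExtendsFamily S f a (Fin.cons a f : Fin (n + 1) → R) := hS
    obtain ⟨n', f', hf', hspan⟩ := ih (by omega) (h.extend_of_cons hS' rfl (by omega))
    refine ⟨n', f', hf', ?_⟩
    have hq : {x | x ∈ a :: q} = insert a {x | x ∈ q} := by
      ext x
      simp
    rw [hspan, Fin.range_cons, hq, Ideal.span_insert, Ideal.span_insert, sup_left_comm, sup_assoc]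

/-- The Koszul depth estimate for ideals generated by variables. -/
theorem isKoszulRegular_of_span_eq_span_X {q zs : List σ} (h : (q ++ zs).Nodup)
    (u : List (MvPolynomial σ k)) {n : ℕ} {f : Fin n → MvPolynomial σ k}
    (hf : Ideal.span (Set.range f) = Ideal.span (X '' {i | i ∈ q})) :
    IsKoszulRegular (zs.map X ++ u) (q.length + zs.length) f := by
  have h0 : IsKoszulRegular (q.map X ++ (zs.map X ++ u)) (q.length + zs.length)
      (varFamily k ([] : List σ)) := by
    rintro (_ | i)
    · refine (LinearEquiv.isWeaklyRegular_congr (koszulHomologyZeroEquiv _) _).1 ?_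
      rw [← List.append_assoc, ← List.map_append, List.take_left' (by simp)]
      exact isWeaklyRegular_X_quotient_span_varFamily (by simpa using h)
    · have := subsingleton_koszulHomology_of_isEmpty (varFamily k ([] : List σ)) i
      exact isWeaklyRegular_of_subsingleton _
  obtain ⟨n', f', hf', hspan⟩ := h0.exists_append _ (by simp)
  refine hf'.of_span_eq (hf.trans ?_)
  rw [hspan, range_varFamily]
  simp [Set.image]

/-- The Koszul depth estimate for ideals generated by some variables and the products of one
further variable `X_r` with `X_r` and some others. -/
theorem isKoszulRegular_of_span_eq_span_X_sup {q zs l : List σ} {r : σ}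
    (h : (q ++ (zs ++ (l ++ [r]))).Nodup)
    (u : List (MvPolynomial σ k)) {n : ℕ} {f : Fin n → MvPolynomial σ k}
    (hf : Ideal.span (Set.range f) = Ideal.span (X '' {i | i ∈ q}) ⊔
      Ideal.span {X r} * Ideal.span (X '' {i | i ∈ l ++ [r]})) :
    IsKoszulRegular ((zs ++ l).map X ++ u) (q.length + zs.length + (l.length + 1)) f := by
  have h0 := isKoszulRegular_X_smul_varFamily (k := k) r u l (q ++ zs) (by simpa using h)
  have hlen : (q ++ zs).length = q.length + zs.length := List.length_append
  rw [List.append_assoc, List.map_append, List.append_assoc, hlen] at h0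
  obtain ⟨n', f', hf', hspan⟩ := h0.exists_append _ (by simp; omega)
  refine hf'.of_span_eq (hf.trans ?_)
  rw [hspan, span_range_smul_family, range_varFamily]
  simp [Set.image]

/-- Padding the regular sequence with zeros covers the degrees in which the Koszul homology
vanishes. -/
theorem le_moduleDepth_add_of_isKoszulRegular {R : Type*} [CommRing R] {n D : ℕ} {f : Fin n → R}
    {J : Ideal R} {w : List R} (hw : ∀ x ∈ w, x ∈ J)
    (h : ∀ N, IsKoszulRegular (w ++ List.replicate N 0) D f) (i : ℕ) :
    ((D + i : ℕ) : ℕ∞) ≤ moduleDepth J (KoszulHomology f i) + (n : ℕ∞) := by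
  let rs := (w ++ List.replicate (D + i) 0).take (D + i - n)
  have hlen : rs.length = D + i - n := by
    simp [rs]
    omega
  have hrs : ((D + i - n : ℕ) : ℕ∞) ≤ moduleDepth J (KoszulHomology f i) := by
    rw [← hlen]
    refine le_iSup₂ (f := fun (rs : List R) (_ : (∀ r ∈ rs, r ∈ J) ∧
      IsWeaklyRegular (KoszulHomology f i) rs) => (rs.length : ℕ∞)) rs ⟨fun x hx => ?_, h _ i⟩
    rcases List.mem_append.1 (List.mem_of_mem_take hx) with hx | hx
    · exact hw x hx
    · rw [List.eq_of_mem_replicate hx]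
      exact J.zero_mem
  calc ((D + i : ℕ) : ℕ∞) ≤ ((D + i - n : ℕ) : ℕ∞) + (n : ℕ∞) := by
        exact_mod_cast (by omega : D + i ≤ D + i - n + n)
    _ ≤ _ := by gcongr

end VariableFamilies

/-! ### A lower bound for the number of generators of a localized ideal -/

section Generators

/-- Nakayama's lemma in coordinates: if `I_p` is generated by fewer than `|ι|` elements, then any
family in `I` indexed by `ι` satisfies, modulo `pI`, a linear relation not all of whose coefficients
are in `p`. -/
theorem exists_relation_of_spanFinrank_lt {R : Type*} [CommRing R] [IsNoetherianRing R]
    (p : Ideal R) [p.IsPrime] (A : Type*) [CommRing A] [Algebra R A]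
    [IsLocalization.AtPrime A p] [IsLocalRing A] (I : Ideal R) {ι : Type*} [Fintype ι] (g : ι → R)
    (hg : ∀ i, g i ∈ I) (h : (I.map (algebraMap R A)).spanFinrank < Fintype.card ι) :
    ∃ u : ι → R, (∃ i, u i ∉ p) ∧ ∑ i, u i * g i ∈ p * I := by
  have hfg : (I.map (algebraMap R A)).FG := Ideal.FG.map (IsNoetherian.noetherian I) _
  obtain ⟨G, hGcard, hGspan⟩ := Submodule.FG.exists_span_finset_card_eq_spanFinrank hfg
  replace hGspan : Ideal.span (Set.range ((↑) : G → A)) = I.map (algebraMap R A) := by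
    rw [Subtype.range_coe]
    exact hGspan
  have hM (i : ι) : ∃ c : G → A, ∑ x, c x * (x : A) = algebraMap R A (g i) := by
    rw [← Ideal.mem_span_range_iff_exists_fun, hGspan]
    exact Ideal.mem_map_of_mem _ (hg i)
  choose M hM using hM
  have hdep : ¬ LinearIndependent (IsLocalRing.ResidueField A)
      (fun i (x : G) => IsLocalRing.residue A (M i x)) := by
    intro hli
    have := hli.fintype_card_le_finrank
    rw [Module.finrank_fintype_fun_eq_card, Fintype.card_coe, hGcard] at this
    exact absurd h this.not_gt
  obtain ⟨c, hc, i₀, hi₀⟩ := Fintype.not_linearIndependent_iff.1 hdep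
  choose c' hc' using fun i => IsLocalRing.residue_surjective (c i)
  obtain ⟨s, hs⟩ := IsLocalization.exist_integer_multiples_of_finite p.primeCompl c'
  choose u hu using hs
  have hmem : algebraMap R A (∑ i, u i * g i) ∈ (p * I).map (algebraMap R A) := by
    rw [Ideal.map_mul, map_sum]
    have h1 : ∑ i, algebraMap R A (u i * g i) =
        ∑ x : G, (∑ i, algebraMap R A (u i) * M i x) * (x : A) := by
      simp_rw [Finset.sum_mul]
      rw [Finset.sum_comm]
      refine Finset.sum_congr rfl fun i _ => ?_
      rw [map_mul, ← hM, Finset.mul_sum]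
      exact Finset.sum_congr rfl fun x _ => by ring
    rw [h1]
    refine Ideal.sum_mem _ fun x _ => Ideal.mul_mem_mul ?_ ?_
    · rw [IsLocalization.AtPrime.map_eq_maximalIdeal p A, ← IsLocalRing.residue_eq_zero_iff, map_sum]
      have h2 : ∀ i, algebraMap R A (u i) = algebraMap R A s * c' i := fun i => by
        rw [hu i, Algebra.smul_def]
      have h3 := congrFun hc x
      simp only [Finset.sum_apply, Pi.smul_apply, smul_eq_mul, Pi.zero_apply] at h3
      simp_rw [h2, map_mul, mul_assoc, hc', ← Finset.mul_sum]
      rw [h3, mul_zero]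
    · rw [← hGspan]
      exact Ideal.subset_span ⟨x, rfl⟩
  obtain ⟨t, ht, htm⟩ :=
    (IsLocalization.algebraMap_mem_map_algebraMap_iff p.primeCompl A _ _).1 hmem
  refine ⟨fun i => t * u i, ⟨i₀, ?_⟩, ?_⟩
  · refine p.primeCompl.mul_mem ht fun hup => hi₀ ?_
    rw [← hc', IsLocalRing.residue_eq_zero_iff]
    have h4 : algebraMap R A (u i₀) ∈ IsLocalRing.maximalIdeal A := by
      rw [← IsLocalization.AtPrime.map_eq_maximalIdeal p A]
      exact Ideal.mem_map_of_mem _ hup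
    rw [hu i₀, Algebra.smul_def] at h4
    exact ((IsLocalRing.maximalIdeal.isMaximal A).isPrime.mem_or_mem h4).resolve_left fun h5 =>
      (IsLocalRing.mem_maximalIdeal _).1 h5 (IsLocalization.map_units A s)
  · simpa [mul_assoc, Finset.mul_sum] using htm

end Generators

section SpanX

open MvPolynomial

variable {k : Type*} [Field k] {σ : Type*}

theorem isPrime_span_X_image (s : Set σ) :
    (Ideal.span (X '' s : Set (MvPolynomial σ k))).IsPrime := by
  classical
  -- The ideal is the kernel of the substitution of `0` for the variables in `s`.
  let φ : MvPolynomial σ k →ₐ[k] MvPolynomial σ k := aeval fun i => if i ∈ s then 0 else X i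
  have hφ : RingHom.ker φ = Ideal.span (X '' s) := by
    apply le_antisymm
    · have key (x : MvPolynomial σ k) : x - φ x ∈ Ideal.span (X '' s : Set (MvPolynomial σ k)) := by
        induction x using MvPolynomial.induction_on with
        | C a => simp [φ]
        | add x y hx hy =>
          rw [map_add, add_sub_add_comm]
          exact add_mem hx hy
        | mul_X x i hx =>
          have hi : (X i : MvPolynomial σ k) - φ (X i) ∈ Ideal.span (X '' s) := by
            by_cases h : i ∈ s
            · simpa [φ, h] using Ideal.subset_span (Set.mem_image_of_mem X h)
            · simp [φ, h]
          rw [map_mul, show x * X i - φ x * φ (X i) = (x - φ x) * X i + φ x * (X i - φ (X i)) by ring]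
          exact add_mem (Ideal.mul_mem_right _ _ hx) (Ideal.mul_mem_left _ _ hi)
      intro x hx
      simpa [RingHom.mem_ker.1 hx] using key x
    · rw [Ideal.span_le]
      rintro _ ⟨i, hi, rfl⟩
      simp [φ, hi]
  rw [← hφ]
  exact RingHom.ker_isPrime _

theorem height_span_X_image_le {d : ℕ} (s : Finset (Fin d)) :
    (Ideal.span (X '' (s : Set (Fin d)) : Set (MvPolynomial (Fin d) k))).height ≤ s.card := by
  classical
  refine (Ideal.height_le_spanFinrank _ (isPrime_span_X_image _).ne_top).trans ?_
  have h := Submodule.spanFinrank_span_le_ncard_of_finite (R := MvPolynomial (Fin d) k)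
    (s.finite_toSet.image (X : Fin d → MvPolynomial (Fin d) k))
  refine (Nat.cast_le.2 (h.trans (Set.ncard_image_le s.finite_toSet))).trans ?_
  rw [Set.ncard_coe_finset]

/-- Monomials whose parts in the variables of `s` do not divide each other, and are not divisible
by the part of any generator of `pI`, are linearly independent in `I_p/pI_p`, where `p` is generated
by the variables in `s`. -/
theorem sum_mul_monomial_notMem {s : Set σ} {I : Ideal (MvPolynomial σ k)} {T : Set (σ →₀ ℕ)}
    (hI : I = Ideal.span ((fun m => monomial m (1 : k)) '' T)) {ι : Type*} [Fintype ι]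
    {e : ι → σ →₀ ℕ} (he : ∀ i i', (∀ l ∈ s, e i l ≤ e i' l) → i = i')
    (hT : ∀ i, ∀ l ∈ s, ∀ m ∈ T, ¬ ∀ t ∈ s, (Finsupp.single l 1 + m : σ →₀ ℕ) t ≤ e i t)
    {u : ι → MvPolynomial σ k} {i₀ : ι} (hu : u i₀ ∉ Ideal.span (X '' s : Set (MvPolynomial σ k))) :
    ∑ i, u i * monomial (e i) (1 : k) ∉ Ideal.span (X '' s) * I := by
  classical
  intro hmem
  rw [mem_ideal_span_X_image] at hu
  push Not at hu
  obtain ⟨m, hm, hms⟩ := hu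
  have hpI : Ideal.span (X '' s) * I = Ideal.span ((fun m => monomial m (1 : k)) ''
      (Set.image2 (fun l m => Finsupp.single l 1 + m) s T)) := by
    rw [hI, Ideal.span_mul_span', ← Set.image2_mul, Set.image2_image_left, Set.image2_image_right,
      Set.image_image2]
    congr! 3
    simp [X, monomial_mul]
  rw [hpI, mem_ideal_span_monomial_image] at hmem
  obtain ⟨_, ⟨l, hl, m', hm', rfl⟩, hle⟩ := hmem (m + e i₀) (by
    rw [mem_support_iff, coeff_sum, Finset.sum_eq_single i₀]
    · rw [coeff_mul_monomial, mul_one]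
      exact mem_support_iff.1 hm
    · intro i _ hi
      rw [coeff_mul_monomial', if_neg]
      intro hle
      refine hi (he i i₀ fun l hl => ?_)
      simpa [hms l hl] using hle l
    · simp)
  refine hT i₀ l hl m' hm' fun t ht => ?_
  simpa [hms t ht] using hle t

end SpanX

/-! ### Strongly stable ideals generated in degree two -/

section StronglyStable

open MvPolynomial

variable {k : Type*} [Field k] {d : ℕ} {I : Ideal (MvPolynomial (Fin d) k)}

/-- The exponent vectors of the quadratic monomials in `I`. -/
def quadraticExponents (I : Ideal (MvPolynomial (Fin d) k)) : Set (Fin d →₀ ℕ) :=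
  {m | ∃ a b, m = Finsupp.single a 1 + Finsupp.single b 1 ∧ X a * X b ∈ I}

theorem X_mul_X_eq_monomial {σ : Type*} (a b : σ) :
    (X a * X b : MvPolynomial σ k) = monomial (Finsupp.single a 1 + Finsupp.single b 1) 1 := by
  simp [X, monomial_mul]

theorem Finsupp.exists_eq_single_add_single_of_degree_eq_two {σ : Type*} {m : σ →₀ ℕ}
    (hm : m.degree = 2) : ∃ a b, m = Finsupp.single a 1 + Finsupp.single b 1 := by
  have key (m : σ →₀ ℕ) (n : ℕ) (h : m.degree = n + 1) :
      ∃ a m', m'.degree = n ∧ m = Finsupp.single a 1 + m' := by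
    have h0 : m ≠ 0 := by
      rintro rfl
      simp at h
    obtain ⟨a, ha⟩ := Finsupp.ne_iff.1 h0
    have hle : Finsupp.single a 1 ≤ m := by
      rw [Finsupp.single_le_iff]
      exact Nat.one_le_iff_ne_zero.2 ha
    refine ⟨a, m - Finsupp.single a 1, ?_, (add_tsub_cancel_of_le hle).symm⟩
    have := congrArg Finsupp.degree (add_tsub_cancel_of_le hle)
    rw [map_add, Finsupp.degree_single, h] at this
    omega
  obtain ⟨a, m', hm', rfl⟩ := key m 1 hm
  obtain ⟨b, m'', hm'', rfl⟩ := key m' 0 hm'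
  rw [Finsupp.degree_eq_zero_iff] at hm''
  exact ⟨a, b, by rw [hm'', add_zero]⟩

theorem not_single_add_le_single_add_single {σ : Type*} {l a b x y : σ}
    (hl : (Finsupp.single l 1 + (Finsupp.single a 1 + Finsupp.single b 1) : σ →₀ ℕ) l ≤
      (Finsupp.single x 1 + Finsupp.single y 1 : σ →₀ ℕ) l)
    (ha : (Finsupp.single l 1 + (Finsupp.single a 1 + Finsupp.single b 1) : σ →₀ ℕ) a ≤
      (Finsupp.single x 1 + Finsupp.single y 1 : σ →₀ ℕ) a)
    (hb : (Finsupp.single l 1 + (Finsupp.single a 1 + Finsupp.single b 1) : σ →₀ ℕ) b ≤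
      (Finsupp.single x 1 + Finsupp.single y 1 : σ →₀ ℕ) b) : False := by
  classical
  simp only [Finsupp.add_apply, Finsupp.single_apply] at hl ha hb
  grind

theorem eq_span_quadraticExponents (hI : IsMonomialIdeal I) (hdeg : IsGeneratedInDegree 2 I) :
    I = Ideal.span ((fun m => monomial m (1 : k)) '' quadraticExponents I) := by
  obtain ⟨M, hM⟩ := hI
  obtain ⟨S, hS, hIS⟩ := hdeg
  apply le_antisymm
  · nth_rw 1 [hIS]
    rw [Ideal.span_le]
    intro f hf
    have hfI : f ∈ I := hIS ▸ Ideal.subset_span hf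
    rw [SetLike.mem_coe, mem_ideal_span_monomial_image]
    intro m hm
    have hmI : monomial m (1 : k) ∈ I := by
      rw [hM, mem_ideal_span_monomial_image] at hfI ⊢
      intro m' hm'
      exact Finset.mem_singleton.1 (support_monomial_subset hm') ▸ hfI m hm
    have hm2 : m.degree = 2 := by
      rw [Finsupp.degree_eq_weight_one]
      exact hS f hf (mem_support_iff.1 hm)
    obtain ⟨a, b, rfl⟩ := Finsupp.exists_eq_single_add_single_of_degree_eq_two hm2
    exact ⟨_, ⟨a, b, rfl, by rwa [X_mul_X_eq_monomial]⟩, le_rfl⟩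
  · rw [Ideal.span_le]
    rintro _ ⟨_, ⟨a, b, rfl, h⟩, rfl⟩
    change monomial _ 1 ∈ I
    rwa [← X_mul_X_eq_monomial]

theorem IsStronglyStable.X_mul_X_mem (hI : IsStronglyStable I) {i j a : Fin d}
    (h : X i * X j ∈ I) (ha : a ≤ i) : X a * X j ∈ I := by
  rcases ha.eq_or_lt with rfl | ha
  · exact h
  · have := hI.2 (Finsupp.single i 1 + Finsupp.single j 1) (by rwa [← X_mul_X_eq_monomial]) a i ha
      (by simp)
    rwa [add_tsub_cancel_left, ← X_mul_X_eq_monomial, mul_comm] at this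

theorem IsStronglyStable.X_mul_X_mem' (hI : IsStronglyStable I) {i j a b : Fin d}
    (h : X i * X j ∈ I) (ha : a ≤ i) (hb : b ≤ j) : X a * X b ∈ I := by
  have := hI.X_mul_X_mem h ha
  rw [mul_comm] at this ⊢
  exact hI.X_mul_X_mem this hb

/-- Let `X_r ^ 2 ∈ I` with `r` maximal. If `q < r < j` and `X_q X_j ∉ I`, with `j` minimal, then
the localization of `I` at the prime ideal generated by the `X_l` with `l < j` needs more
generators than its height. Linearly independent modulo `p I_p` are `X_q ^ 2` and, for every `l < j`,
the following element: `X_l X_j` (an associate of `X_l`) if it is in `I`, and otherwise `X_l X_r` or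
`X_q X_l`, according to whether `l ≤ r`. -/
theorem X_mul_X_mem_of_hasG (hI : IsStronglyStable I) (hdeg : IsGeneratedInDegree 2 I)
    (hG : HasG d I) {r : Fin d} (hr : X r * X r ∈ I) (hmax : ∀ i, r < i → X i * X i ∉ I)
    {q : Fin d} (hq : q < r) (j : Fin d) (hj : r < j) : X q * X j ∈ I := by
  classical
  induction j using WellFoundedLT.induction with
  | ind j ih =>
    by_contra hqj
    have hrj : X r * X j ∉ I := fun h => hqj (hI.X_mul_X_mem h hq.le)
    have hlow {a b : Fin d} (h : X a * X b ∈ I) (hab : a ≤ b) : a ≤ r :=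
      le_of_not_gt fun hra => hmax a hra (hI.X_mul_X_mem' h le_rfl hab)
    have hspan := eq_span_quadraticExponents hI.1 hdeg
    let s : Finset (Fin d) := Finset.Iio j
    let p : Ideal (MvPolynomial (Fin d) k) := Ideal.span (X '' (s : Set (Fin d)))
    have hp : p.IsPrime := isPrime_span_X_image _
    have hIp : I ≤ p := by
      rw [hspan, Ideal.span_le]
      rintro _ ⟨_, ⟨a, b, rfl, h⟩, rfl⟩
      change monomial _ 1 ∈ p
      rw [← X_mul_X_eq_monomial]
      have hmem (a : Fin d) (ha : a ≤ r) : X a ∈ p :=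
        Ideal.subset_span ⟨a, by simpa [s] using ha.trans_lt hj, rfl⟩
      rcases le_total a b with hab | hab
      · exact p.mul_mem_right _ (hmem a (hlow h hab))
      · exact p.mul_mem_left _ (hmem b (hlow (by rwa [mul_comm]) hab))
    have hht : p.height ≤ (j : ℕ) := by
      have := height_span_X_image_le (k := k) s
      rwa [Fin.card_Iio] at this
    have hμ := hG p hIp (hht.trans_lt (by exact_mod_cast j.2))
    have hμ' : (I.map (algebraMap _ (Localization.AtPrime p))).spanFinrank ≤ j := by
      exact_mod_cast hμ.trans hht
    let e : Option s → Fin d →₀ ℕ := fun o => o.elim (Finsupp.single q 1 + Finsupp.single q 1)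
      fun l => if X l.1 * X j ∈ I then Finsupp.single l.1 1 + Finsupp.single j 1 else
        if l.1 ≤ r then Finsupp.single l.1 1 + Finsupp.single r 1 else
          Finsupp.single q 1 + Finsupp.single l.1 1
    obtain ⟨u, ⟨i₀, hu⟩, hsum⟩ := exists_relation_of_spanFinrank_lt p (Localization.AtPrime p) I
      (fun o => monomial (e o) (1 : k)) (fun o => by
        rcases o with _ | ⟨l, hl⟩
        · simp only [e, Option.elim_none]
          rw [← X_mul_X_eq_monomial]
          exact hI.X_mul_X_mem' hr hq.le hq.le
        · simp only [e, Option.elim_some]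
          have hl' : l < j := by simpa [s] using hl
          split_ifs with h1 h2
          · rwa [← X_mul_X_eq_monomial]
          · rw [← X_mul_X_eq_monomial]
            exact hI.X_mul_X_mem hr h2
          · rw [← X_mul_X_eq_monomial]
            exact ih l hl' (not_le.1 h2)) (by
        refine hμ'.trans_lt ?_
        rw [Fintype.card_option, Fintype.card_coe, Fin.card_Iio]
        exact Nat.lt_succ_self _)
    refine sum_mul_monomial_notMem hspan (e := e) (s := (s : Set (Fin d))) ?_ ?_ hu hsum
    · intro i i' h
      have hqr := hq.ne
      have hsq := h q (by simpa [s] using hq.trans hj)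
      have hsr := h r (by simpa [s] using hj)
      rcases i with _ | ⟨l, hl⟩
      · rcases i' with _ | ⟨l', hl'⟩
        · rfl
        · have hl'j : l' < j := by simpa [s] using hl'
          simp only [e, Option.elim_none, Option.elim_some] at hsq
          split_ifs at hsq <;> simp [Finsupp.single_apply] at hsq <;> grind
      · have hlj : l < j := by simpa [s] using hl
        have hsl := h l (by simpa [s] using hlj)
        rcases i' with _ | ⟨l', hl'⟩
        · simp only [e, Option.elim_none, Option.elim_some] at hsl hsr
          split_ifs at hsl hsr <;> simp [Finsupp.single_apply] at hsl hsr <;> grind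
        · have hl'j : l' < j := by simpa [s] using hl'
          simp only [e, Option.elim_some] at hsl hsr
          split_ifs at hsl hsr <;> simp [Finsupp.single_apply] at hsl hsr ⊢ <;> grind
    · rintro i l hl _ ⟨a, b, rfl, hab⟩ h
      wlog hle : a ≤ b generalizing a b
      · exact this b a (by rwa [mul_comm]) (by rwa [add_comm (Finsupp.single b 1)]) (le_of_not_ge hle)
      have hlj : l < j := by simpa [s] using hl
      have har := hlow hab hle
      have haj : a < j := har.trans_lt hj
      have haI : X a * X j ∈ I ∨ b < j :=
        (lt_or_ge b j).symm.imp_left fun hb => hI.X_mul_X_mem' hab le_rfl hb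
      have hla := h l hl
      have haa := h a (by simpa [s] using haj)
      have hbb : b < j → _ := fun hb => h b (by simpa [s] using hb)
      have key (x y : Fin d) (hx : X x * X j ∉ I) (hy : X y * X j ∉ I)
          (hxy : e i = Finsupp.single x 1 + Finsupp.single y 1) : False := by
        rw [hxy] at hla haa hbb
        rcases haI with haI | hb
        · have h1 : a ≠ x := fun h => hx (h ▸ haI)
          have h2 : a ≠ y := fun h => hy (h ▸ haI)
          simp [h1.symm, h2.symm] at haa
        · exact not_single_add_le_single_add_single hla haa (hbb hb)
      rcases i with _ | ⟨t, ht⟩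
      · exact key q q hqj hqj rfl
      · by_cases h1 : X t * X j ∈ I
        · have he : e (some ⟨t, ht⟩) = Finsupp.single t 1 + Finsupp.single j 1 := by simp [e, h1]
          rw [he] at hla haa
          have hlt : t = l := by
            by_contra hne
            simp [Finsupp.single_apply, hlj.ne', hne] at hla
          subst hlt
          by_cases hat : t = a
          · subst hat
            simp [Finsupp.single_apply, hlj.ne'] at haa
          · simp [Finsupp.single_apply, haj.ne', hat] at haa
        · by_cases h2 : t ≤ r
          · exact key t r h1 hrj (by simp [e, h1, h2])
          · exact key q t hqj h1 (by simp [e, h1, h2])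

end StronglyStable

/-! ### The saturation and its sliding depth -/

section Saturation

open MvPolynomial

variable {k : Type*} [Field k] {d : ℕ} {I : Ideal (MvPolynomial (Fin d) k)}

theorem mem_idealSaturation_of_forall {R : Type*} [CommRing R] {I J : Ideal R} {f : R} (t : ℕ)
    (h : ∀ g ∈ J ^ t, f * g ∈ I) : f ∈ idealSaturation I J :=
  le_iSup (fun t : ℕ => I.colon ((J ^ t : Ideal R) : Set R)) t (Submodule.mem_colon.2 h)

theorem le_idealSaturation {R : Type*} [CommRing R] (I J : Ideal R) : I ≤ idealSaturation I J :=
  fun _ hf => mem_idealSaturation_of_forall 0 fun _ _ => I.mul_mem_right _ hf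

theorem X_mem_idealSaturation (hI : IsStronglyStable I) {i z : Fin d} (hz : ∀ l, l ≤ z)
    (h : X i * X z ∈ I) : X i ∈ idealSaturation I (idealOfVars (Fin d) k) := by
  refine mem_idealSaturation_of_forall 1 fun g hg => ?_
  rw [pow_one] at hg
  have hle : idealOfVars (Fin d) k ≤ Submodule.comap (LinearMap.mulLeft _ (X i)) I := by
    rw [idealOfVars, Ideal.span_le]
    rintro _ ⟨l, rfl⟩
    exact hI.X_mul_X_mem' h le_rfl (hz l)
  exact hle hg

theorem idealSaturation_eq_top (hI : IsStronglyStable I) {z : Fin d} (hz : ∀ l, l ≤ z)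
    (h : X z * X z ∈ I) : idealSaturation I (idealOfVars (Fin d) k) = ⊤ := by
  rw [Ideal.eq_top_iff_one]
  refine mem_idealSaturation_of_forall 2 fun g hg => ?_
  rw [one_mul]
  have hle : idealOfVars (Fin d) k ^ 2 ≤ I := by
    rw [sq, idealOfVars, Ideal.span_mul_span', Ideal.span_le]
    rintro _ ⟨_, ⟨a, rfl⟩, _, ⟨b, rfl⟩, rfl⟩
    exact hI.X_mul_X_mem' h (hz a) (hz b)
  exact hle hg

/-- An ideal generated by monomials not divisible by the variable `X_z` is saturated. -/
theorem idealSaturation_le_of_span_monomial {J : Ideal (MvPolynomial (Fin d) k)} (hIJ : I ≤ J)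
    {T : Set (Fin d →₀ ℕ)} {z : Fin d} (hT : ∀ m ∈ T, m z = 0)
    (hJ : J = Ideal.span ((fun m => monomial m (1 : k)) '' T)) :
    idealSaturation I (idealOfVars (Fin d) k) ≤ J := by
  refine iSup_le fun t f hf => ?_
  have hfz : f * monomial (Finsupp.single z t) (1 : k) ∈ J := by
    rw [← X_pow_eq_monomial]
    exact hIJ (Submodule.mem_colon.1 hf _
      (Ideal.pow_mem_pow (Ideal.subset_span (Set.mem_range_self z)) t))
  rw [hJ, mem_ideal_span_monomial_image] at hfz ⊢
  intro m hm
  obtain ⟨m', hm', hle⟩ := hfz (m + Finsupp.single z t) (by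
    rw [mem_support_iff] at hm ⊢
    rwa [coeff_mul_monomial, mul_one])
  refine ⟨m', hm', fun l => ?_⟩
  by_cases hl : z = l
  · subst hl
    simp [hT m' hm']
  · simpa [hl] using hle l

theorem span_X_image_eq_span_monomial {σ : Type*} (s : Set σ) :
    Ideal.span (X '' s : Set (MvPolynomial σ k)) =
      Ideal.span ((fun m => monomial m (1 : k)) '' ((fun i => Finsupp.single i 1) '' s)) := by
  rw [Set.image_image]
  rfl

/-- The saturation, if the variables whose squares are in `I` are those up to `X_r` and
`X_r X_z ∈ I` for the last variable `X_z`. -/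
theorem idealSaturation_eq_span_X (hI : IsStronglyStable I) (hdeg : IsGeneratedInDegree 2 I)
    {z : Fin d} (hz : ∀ l, l ≤ z) (hzz : X z * X z ∉ I) {Q : Set (Fin d)}
    (hQ : ∀ i ∈ Q, X i * X z ∈ I) (hQI : ∀ i, X i * X i ∈ I → i ∈ Q) :
    idealSaturation I (idealOfVars (Fin d) k) = Ideal.span (X '' Q) := by
  apply le_antisymm
  · refine idealSaturation_le_of_span_monomial (z := z) ?_ ?_ (span_X_image_eq_span_monomial Q)
    · rw [eq_span_quadraticExponents hI.1 hdeg, Ideal.span_le]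
      rintro _ ⟨_, ⟨a, b, rfl, h⟩, rfl⟩
      change monomial _ 1 ∈ Ideal.span (X '' Q : Set (MvPolynomial (Fin d) k))
      rw [← X_mul_X_eq_monomial]
      rcases le_total a b with hab | hab
      · exact Ideal.mul_mem_right _ _ (Ideal.subset_span
          ⟨a, hQI a (hI.X_mul_X_mem' h le_rfl hab), rfl⟩)
      · exact Ideal.mul_mem_left _ _ (Ideal.subset_span
          ⟨b, hQI b (hI.X_mul_X_mem' h hab le_rfl), rfl⟩)
    · rintro _ ⟨i, hi, rfl⟩
      have : i ≠ z := fun h => hzz (h ▸ hQ i hi)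
      simp [this]
  · rw [Ideal.span_le]
    rintro _ ⟨i, hi, rfl⟩
    exact X_mem_idealSaturation hI hz (hQ i hi)

/-- The saturation, if `X_i X_z ∈ I` for all `i < r`, but not for `i = r`, where `X_z` is the last
variable and `X_r` the last variable whose square is in `I`. -/
theorem idealSaturation_eq_span_X_sup (hI : IsStronglyStable I) (hdeg : IsGeneratedInDegree 2 I)
    {z r : Fin d} (hz : ∀ l, l ≤ z) (hr : ∀ i, X i * X i ∈ I → i ≤ r)
    (hlt : ∀ i < r, X i * X z ∈ I) (hrr : X r * X r ∈ I) (hrz : X r * X z ∉ I) :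
    idealSaturation I (idealOfVars (Fin d) k) =
      Ideal.span (X '' {i | i < r}) ⊔
        Ideal.span {X r} * Ideal.span (X '' {i | r ≤ i ∧ X r * X i ∈ I}) := by
  have hrz' : r ≠ z := fun h => hrz (by rwa [← h])
  apply le_antisymm
  · refine idealSaturation_le_of_span_monomial (z := z) ?_
      (T := (fun i => Finsupp.single i 1) '' {i | i < r} ∪
        (fun i => Finsupp.single r 1 + Finsupp.single i 1) '' {i | r ≤ i ∧ X r * X i ∈ I}) ?_ ?_
    · rw [eq_span_quadraticExponents hI.1 hdeg, Ideal.span_le]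
      rintro _ ⟨_, ⟨a, b, rfl, h⟩, rfl⟩
      rw [SetLike.mem_coe]
      change monomial _ 1 ∈ _
      rw [← X_mul_X_eq_monomial]
      have key {a b : Fin d} (h : X a * X b ∈ I) (hab : a ≤ b) :
          (X a * X b : MvPolynomial (Fin d) k) ∈ Ideal.span (X '' {i | i < r}) ⊔
            Ideal.span {X r} * Ideal.span (X '' {i | r ≤ i ∧ X r * X i ∈ I}) := by
        rcases (hr a (hI.X_mul_X_mem' h le_rfl hab)).lt_or_eq with ha | rfl
        · exact Ideal.mem_sup_left (Ideal.mul_mem_right _ _ (Ideal.subset_span ⟨a, ha, rfl⟩))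
        · exact Ideal.mem_sup_right (Ideal.mul_mem_mul (Ideal.mem_span_singleton_self _)
            (Ideal.subset_span ⟨b, ⟨hab, h⟩, rfl⟩))
      have hquad : Ideal.span ((fun m => monomial m (1 : k)) '' quadraticExponents I) = I :=
        (eq_span_quadraticExponents hI.1 hdeg).symm
      simp only [hquad]
      rcases le_total a b with hab | hab
      · exact key h hab
      · rw [mul_comm (X a) (X b)] at h ⊢
        exact key h hab
    · rintro _ (⟨i, hi, rfl⟩ | ⟨i, ⟨-, hi⟩, rfl⟩)
      · have : i ≠ z := (lt_of_lt_of_le hi (hz r)).ne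
        simp [this]
      · have : i ≠ z := fun h => hrz (h ▸ hi)
        simp [this, hrz']
    · rw [Set.image_union, Ideal.span_union, ← span_X_image_eq_span_monomial, Ideal.span_mul_span',
        Set.singleton_mul, Set.image_image, Set.image_image]
      simp only [X_mul_X_eq_monomial]
  · refine sup_le ?_ ?_
    · rw [Ideal.span_le]
      rintro _ ⟨i, hi, rfl⟩
      exact X_mem_idealSaturation hI hz (hlt i hi)
    · rw [Ideal.span_mul_span', Set.singleton_mul, Set.image_image, Ideal.span_le]
      rintro _ ⟨i, hi, rfl⟩
      exact le_idealSaturation I _ hi.2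

theorem X_mem_idealOfVars_of_mem_map {zs : List (Fin d)} :
    ∀ x ∈ zs.map (X : Fin d → MvPolynomial (Fin d) k), x ∈ idealOfVars (Fin d) k := by
  intro x hx
  obtain ⟨i, -, rfl⟩ := List.mem_map.1 hx
  exact Ideal.subset_span (Set.mem_range_self i)

theorem hasSlidingDepth_span_X (Q : Set (Fin d)) :
    HasSlidingDepth (Ideal.span (X '' Q : Set (MvPolynomial (Fin d) k))) := by
  classical
  intro n f hf i
  let q : List (Fin d) := (Finset.univ.filter (· ∈ Q)).toList
  let zs : List (Fin d) := (Finset.univ.filter (· ∉ Q)).toList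
  have hq : {i | i ∈ q} = Q := by
    ext
    simp [q]
  have hnd : (q ++ zs).Nodup := by
    refine List.nodup_append'.2 ⟨Finset.nodup_toList _, Finset.nodup_toList _, fun i hi hi' => ?_⟩
    simp only [q, zs, Finset.mem_toList, Finset.mem_filter] at hi hi'
    exact hi'.2 hi.2
  have hlen : q.length + zs.length = d := by
    simp only [q, zs, Finset.length_toList]
    rw [Finset.card_filter_add_card_filter_not, Finset.card_univ, Fintype.card_fin]
  rw [← hq] at hf
  refine le_moduleDepth_add_of_isKoszulRegular (X_mem_idealOfVars_of_mem_map (zs := zs))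
    (fun N => ?_) i
  have := isKoszulRegular_of_span_eq_span_X hnd (List.replicate N 0) hf.1
  rwa [hlen] at this

theorem hasSlidingDepth_span_X_sup {Q P : Set (Fin d)} {r : Fin d} (hrP : r ∈ P)
    (hPQ : Disjoint Q P) :
    HasSlidingDepth (Ideal.span (X '' Q : Set (MvPolynomial (Fin d) k)) ⊔
      Ideal.span {X r} * Ideal.span (X '' P)) := by
  classical
  intro n f hf i
  let q : List (Fin d) := (Finset.univ.filter (· ∈ Q)).toList
  let l : List (Fin d) := ((Finset.univ.filter (· ∈ P)).erase r).toList
  let zs : List (Fin d) := (Finset.univ.filter (fun i => ¬ (i ∈ Q ∨ i ∈ P))).toList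
  have hq : {i | i ∈ q} = Q := by
    ext
    simp [q]
  have hl : {i | i ∈ l ++ [r]} = P := by
    ext i
    by_cases h : i = r
    · simp [h, hrP]
    · simp [l, h]
  have hP (i : Fin d) : i ∈ l ++ [r] ↔ i ∈ P := Set.ext_iff.1 hl i
  have hlr : (l ++ [r]).Nodup :=
    List.nodup_append'.2 ⟨Finset.nodup_toList _, by simp, by simp [l, List.disjoint_singleton]⟩
  have hzl : (zs ++ (l ++ [r])).Nodup := by
    refine List.nodup_append'.2 ⟨Finset.nodup_toList _, hlr, fun i hi hi' => ?_⟩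
    simp only [zs, Finset.mem_toList, Finset.mem_filter] at hi
    exact hi.2 (Or.inr ((hP i).1 hi'))
  have hnd : (q ++ (zs ++ (l ++ [r]))).Nodup := by
    refine List.nodup_append'.2 ⟨Finset.nodup_toList _, hzl, fun i hi hi' => ?_⟩
    simp only [q, Finset.mem_toList, Finset.mem_filter] at hi
    rcases List.mem_append.1 hi' with h | h
    · simp only [zs, Finset.mem_toList, Finset.mem_filter] at h
      exact h.2 (Or.inl hi.2)
    · exact Set.disjoint_left.1 hPQ hi.2 ((hP i).1 h)
  have hlen : q.length + zs.length + (l.length + 1) = d := by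
    have h1 := List.toFinset_card_of_nodup hnd
    have h2 : (q ++ (zs ++ (l ++ [r]))).toFinset = Finset.univ := by
      refine Finset.eq_univ_of_forall fun i => ?_
      rw [List.mem_toFinset, List.mem_append, List.mem_append, hP]
      simp only [q, zs, Finset.mem_toList, Finset.mem_filter, Finset.mem_univ, true_and]
      tauto
    rw [h2, Finset.card_univ, Fintype.card_fin] at h1
    simp only [List.length_append, List.length_singleton] at h1
    omega
  rw [← hq, ← hl] at hf
  refine le_moduleDepth_add_of_isKoszulRegular (X_mem_idealOfVars_of_mem_map (zs := zs ++ l))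
    (fun N => ?_) i
  have := isKoszulRegular_of_span_eq_span_X_sup hnd (List.replicate N 0) hf.1
  rwa [hlen] at this

theorem hasSlidingDepth_top : HasSlidingDepth (⊤ : Ideal (MvPolynomial (Fin d) k)) :=
  fun _ _ hf i => le_moduleDepth_add_of_isKoszulRegular (w := []) (by simp)
    (fun _ => isKoszulRegular_of_span_eq_top hf.1 _ _) i

end Saturation

end

theorem proposition3p2 {k : Type*} [Field k] [CharZero k] {d : ℕ}
    (I : Ideal (MvPolynomial (Fin d) k)) (hI : IsStronglyStable I)
    (hdeg : IsGeneratedInDegree 2 I) (hG : HasG d I) :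
    HasSlidingDepth (idealSaturation I (MvPolynomial.idealOfVars (Fin d) k)) := by
  classical
  open MvPolynomial in
  rcases d with _ | d
  · -- Without variables, the maximal ideal is zero, so that `(I : 𝔪)` is the unit ideal.
    have htop : idealSaturation I (idealOfVars (Fin 0) k) = ⊤ := by
      rw [Ideal.eq_top_iff_one]
      refine mem_idealSaturation_of_forall 1 fun g hg => ?_
      rw [pow_one, idealOfVars, Set.range_eq_empty, Ideal.span_empty, Ideal.mem_bot] at hg
      rw [hg, mul_zero]
      exact I.zero_mem
    rw [htop]
    exact hasSlidingDepth_top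
  · have hz : ∀ l : Fin (d + 1), l ≤ Fin.last d := Fin.le_last
    by_cases hzz : X (Fin.last d) * X (Fin.last d) ∈ I
    · rw [idealSaturation_eq_top hI hz hzz]
      exact hasSlidingDepth_top
    let A : Finset (Fin (d + 1)) := Finset.univ.filter fun i => X i * X i ∈ I
    rcases A.eq_empty_or_nonempty with hA | hA
    · rw [idealSaturation_eq_span_X (Q := ∅) hI hdeg hz hzz (by simp) fun i hi =>
        (Finset.notMem_empty i
          (hA ▸ (Finset.mem_filter.2 ⟨Finset.mem_univ i, hi⟩ : i ∈ A))).elim]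
      exact hasSlidingDepth_span_X _
    · let r := A.max' hA
      have hrr : X r * X r ∈ I := (Finset.mem_filter.1 (A.max'_mem hA)).2
      have hr (i : Fin (d + 1)) (hi : X i * X i ∈ I) : i ≤ r :=
        A.le_max' i (Finset.mem_filter.2 ⟨Finset.mem_univ i, hi⟩)
      have hrz : r < Fin.last d := (hz r).lt_of_ne fun h => hzz (h ▸ hrr)
      have hlt (i : Fin (d + 1)) (hi : i < r) : X i * X (Fin.last d) ∈ I :=
        X_mul_X_mem_of_hasG hI hdeg hG hrr (fun j hj h => hj.not_ge (hr j h)) hi _ hrz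
      by_cases hrz' : X r * X (Fin.last d) ∈ I
      · rw [idealSaturation_eq_span_X (Q := {i | i ≤ r}) hI hdeg hz hzz
          (fun i hi => hI.X_mul_X_mem hrz' hi) hr]
        exact hasSlidingDepth_span_X _
      · rw [idealSaturation_eq_span_X_sup hI hdeg hz hr hlt hrr hrz']
        exact hasSlidingDepth_span_X_sup (by exact ⟨le_rfl, hrr⟩)
          (Set.disjoint_left.2 fun i hi hi' => hi'.1.not_gt hi)
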